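/- Let $K$ be a field of characteristic zero (for example $K=\mathbb C$). Let $\mathrm{Vir}$ be the Virasoro algebra over $K$, that is, the Lie algebra with basis $\{e_n : n\in\mathbb Z\}\cup\{c\}$, with $c$ central and $$[e_i,e_j]=(j-i)e_{i+j}+\frac{i^3-i}{12}\,\delta_{i+j,0}\,c .$$ Let $\mathfrak b_+$ be the subalgebra spanned by $c$ and the $e_n$ with $n\ge 0$, and let $\mathfrak n'$ be the subalgebra spanned by $c$ and the $e_n$ with $n\ge 1$. For $\kappa\in K$ let $(c-\kappa)$ be the two-sided ideal of $U(\mathrm{Vir})$ generated by $c-\kappa$. 1. Let $\kappa\in K$ and let $M'$ be a nonzero representation of $\mathfrak b_+$, of arbitrary dimension, with central character $\kappa$, that is, on which $c$ acts as the scalar $\kappa$. Let $M=U(\mathrm{Vir})\otimes_{U(\mathfrak b_+)}M'$ be the induced module. Then $\mathrm{Ann}_{U(\mathrm{Vir})}M=(c-\kappa)$. 2. (Verma modules.) Let $\kappa,\lambda\in K$ and let $K_{\kappa,\lambda}$ be the one-dimensional representation of $\mathfrak b_+$ on which $c$ acts as $\kappa$, $e_0$ acts as $\lambda$, and $e_n$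 acts as $0$ for all $n\ge 1$. Then the annihilator in $U(\mathrm{Vir})$ of the Verma module $U(\mathrm{Vir})\otimes_{U(\mathfrak b_+)}K_{\kappa,\lambda}$ is $(c-\kappa)$. 3. (Logarithmic modules.) Let $M'$ be a finite-dimensional representation of $\mathfrak b_+$ on which $e_n$ acts as $0$ for all $n\ge 1$, $c$ acts as a scalar, and $e_0$ acts as a non-semisimple operator. Then there is $\kappa\in K$ such that $c$ acts on $M'$ as $\kappa$ and $\mathrm{Ann}_{U(\mathrm{Vir})}\bigl(U(\mathrm{Vir})\otimes_{U(\mathfrak b_+)}M'\bigr)=(c-\kappa)$. 4. (Whittaker modules.) Let $M''$ be a one-dimensional representation of $\mathfrak n'$ on which $c$ acts as a scalar and $e_n$ acts as $0$ for all $n\ge 3$. Then there is $\kappa\in K$ such that $c$ acts on $M''$ as $\kappa$ and $\mathrm{Ann}_{U(\mathrm{Vir})}\bigl(U(\mathrm{Vir})\otimes_{U(\mathfrak n')}M''\bigr)=(c-\kappa)$. -/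

import Mathlib

open scoped TensorProduct

universe u v w

noncomputable section

section Induced

attribute [local instance 100] LieRing.ofAssociativeRing

variable (R : Type u) [CommRing R] {L : Type v} [LieRing L] [LieAlgebra R L]

/-- The algebra homomorphism `U(H) → U(L)` given by the inclusion of a Lie subalgebra `H` of `L`. -/
def envelopingIncl (H : LieSubalgebra R L) :
    UniversalEnvelopingAlgebra R H →ₐ[R] UniversalEnvelopingAlgebra R L :=
  UniversalEnvelopingAlgebra.lift R ((UniversalEnvelopingAlgebra.ι R).comp H.incl)

/-- The action of `U(L)` on a Lie module `M` over `L`. -/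
def envelopingAction (L : Type v) [LieRing L] [LieAlgebra R L] (M : Type w) [AddCommGroup M]
    [Module R M] [LieRingModule L M] [LieModule R L M] :
    UniversalEnvelopingAlgebra R L →ₐ[R] Module.End R M :=
  UniversalEnvelopingAlgebra.lift R (LieModule.toEnd R L M)

variable (H : LieSubalgebra R L) (M : Type w) [AddCommGroup M] [Module R M]
  [LieRingModule H M] [LieModule R H M]

/-- The relations `u b ⊗ m = u ⊗ b m`, for `b ∈ U(H)`, that turn `U(L) ⊗_R M` into
`U(L) ⊗_{U(H)} M`. -/
def inducedRelations :
    Submodule (UniversalEnvelopingAlgebra R L) (UniversalEnvelopingAlgebra R L ⊗[R] M) :=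
  Submodule.span (UniversalEnvelopingAlgebra R L)
    {t | ∃ (a : UniversalEnvelopingAlgebra R L) (b : UniversalEnvelopingAlgebra R H) (m : M),
      t = (a * envelopingIncl R H b) ⊗ₜ[R] m - a ⊗ₜ[R] (envelopingAction R H M b m)}

/-- The induced module `U(L) ⊗_{U(H)} M`, as a left module over `U(L)`: the tensor product over the
noncommutative ring `U(H)`, presented as a quotient of the tensor product over `R`. -/
abbrev InducedModule : Type _ :=
  (UniversalEnvelopingAlgebra R L ⊗[R] M) ⧸ inducedRelations R H M

end Induced

/-- The Virasoro algebra: a pair `(f, z)` stands for `∑ i, f i • e_i + z • c`. -/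
def Virasoro (K : Type u) [Field K] : Type u := (ℤ →₀ K) × K

namespace Virasoro

variable (K : Type u) [Field K]

instance : AddCommGroup (Virasoro K) := inferInstanceAs (AddCommGroup ((ℤ →₀ K) × K))

instance : Module K (Virasoro K) := inferInstanceAs (Module K ((ℤ →₀ K) × K))

/-- The basis vectors `e_n`. -/
def e (n : ℤ) : Virasoro K := (Finsupp.single n 1, 0)

/-- The central basis vector `c`. -/
def c : Virasoro K := (0, 1)

/-- The bracket of the Witt algebra, `[e_i, e_j] = (j - i) e_{i+j}`. -/
def wittBracket : (ℤ →₀ K) →ₗ[K] (ℤ →₀ K) →ₗ[K] (ℤ →₀ K) :=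
  Finsupp.linearCombination K fun i : ℤ =>
    Finsupp.linearCombination K fun j : ℤ => Finsupp.single (i + j) ((j : K) - (i : K))

/-- The coefficient of `c` in the bracket, `(i^3 - i) / 12 * δ_{i+j,0}` on `(e_i, e_j)`. -/
def cocycle : (ℤ →₀ K) →ₗ[K] (ℤ →₀ K) →ₗ[K] K :=
  Finsupp.linearCombination K fun i : ℤ =>
    Finsupp.linearCombination K fun j : ℤ =>
      if i + j = 0 then ((i : K) ^ 3 - (i : K)) / 12 else 0

theorem wittBracket_single (i j : ℤ) :
    wittBracket K (Finsupp.single i 1) (Finsupp.single j 1) =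
      Finsupp.single (i + j) ((j : K) - (i : K)) := by
  simp [wittBracket]

theorem cocycle_single (i j : ℤ) :
    cocycle K (Finsupp.single i 1) (Finsupp.single j 1) =
      if i + j = 0 then ((i : K) ^ 3 - (i : K)) / 12 else 0 := by
  simp [cocycle]

theorem wittBracket_skew (f g : ℤ →₀ K) : wittBracket K f g + wittBracket K g f = 0 := by
  have h : wittBracket K + (wittBracket K).flip = 0 := by
    ext i j : 4
    simp only [LinearMap.comp_apply, Finsupp.lsingle_apply, LinearMap.add_apply,
      LinearMap.flip_apply, LinearMap.zero_apply, wittBracket_single]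
    rw [add_comm j i, ← Finsupp.single_add]
    simp
  simpa using LinearMap.congr_fun₂ h f g

theorem cocycle_skew (f g : ℤ →₀ K) : cocycle K f g + cocycle K g f = 0 := by
  have h : cocycle K + (cocycle K).flip = 0 := by
    ext i j : 4
    simp only [LinearMap.comp_apply, Finsupp.lsingle_apply, LinearMap.add_apply,
      LinearMap.flip_apply, LinearMap.zero_apply, cocycle_single]
    by_cases hij : i + j = 0
    · obtain rfl : j = -i := by omega
      simp
      ring
    · rw [if_neg hij, if_neg (by omega)]
      simp
  simpa using LinearMap.congr_fun₂ h f g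

theorem wittBracket_jacobi (f g h : ℤ →₀ K) :
    wittBracket K f (wittBracket K g h) =
      wittBracket K (wittBracket K f g) h + wittBracket K g (wittBracket K f h) := by
  induction f using Finsupp.induction_linear with
  | zero => simp
  | add f₁ f₂ h₁ h₂ => simp only [map_add, LinearMap.add_apply, h₁, h₂]; abel
  | single i a =>
  induction g using Finsupp.induction_linear with
  | zero => simp
  | add f₁ f₂ h₁ h₂ => simp only [map_add, LinearMap.add_apply, h₁, h₂]; abel
  | single j b =>
  induction h using Finsupp.induction_linear with
  | zero => simp
  | add f₁ f₂ h₁ h₂ => simp only [map_add, h₁, h₂]; abel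
  | single k d =>
    simp only [wittBracket, Finsupp.linearCombination_single, LinearMap.smul_apply,
      Finsupp.smul_single, smul_eq_mul]
    rw [show j + (i + k) = i + (j + k) by ring, show i + j + k = i + (j + k) by ring,
      ← Finsupp.single_add]
    congr 1
    push_cast
    ring

theorem cocycle_jacobi (f g h : ℤ →₀ K) :
    cocycle K f (wittBracket K g h) =
      cocycle K (wittBracket K f g) h + cocycle K g (wittBracket K f h) := by
  induction f using Finsupp.induction_linear with
  | zero => simp
  | add f₁ f₂ h₁ h₂ => simp only [map_add, LinearMap.add_apply, h₁, h₂]; abel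
  | single i a =>
  induction g using Finsupp.induction_linear with
  | zero => simp
  | add f₁ f₂ h₁ h₂ => simp only [map_add, LinearMap.add_apply, h₁, h₂]; abel
  | single j b =>
  induction h using Finsupp.induction_linear with
  | zero => simp
  | add f₁ f₂ h₁ h₂ => simp only [map_add, h₁, h₂]; abel
  | single k d =>
    simp only [wittBracket, cocycle, Finsupp.linearCombination_single, LinearMap.smul_apply,
      Finsupp.smul_single, smul_eq_mul]
    by_cases hs : i + (j + k) = 0
    · rw [if_pos hs, if_pos (by omega), if_pos (by omega)]
      obtain rfl : k = -i - j := by omega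
      push_cast
      ring
    · rw [if_neg hs, if_neg (by omega), if_neg (by omega)]
      simp

variable [CharZero K]

/-- The Lie bracket: `[e_i, e_j] = (j - i) e_{i+j} + (i^3 - i) / 12 * δ_{i+j,0} c`, `c` central. -/
instance : LieRing (Virasoro K) where
  bracket x y := (wittBracket K x.1 y.1, cocycle K x.1 y.1)
  add_lie x y z := by
    refine Prod.ext ?_ ?_
    · change wittBracket K (x.1 + y.1) z.1 = wittBracket K x.1 z.1 + wittBracket K y.1 z.1
      simp
    · change cocycle K (x.1 + y.1) z.1 = cocycle K x.1 z.1 + cocycle K y.1 z.1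
      simp
  lie_add x y z := by
    refine Prod.ext ?_ ?_
    · exact map_add (wittBracket K x.1) y.1 z.1
    · exact map_add (cocycle K x.1) y.1 z.1
  lie_self x := by
    refine Prod.ext ?_ ?_
    · change wittBracket K x.1 x.1 = 0
      have h := wittBracket_skew K x.1 x.1
      rw [← two_smul K] at h
      exact (smul_eq_zero.mp h).resolve_left two_ne_zero
    · change cocycle K x.1 x.1 = 0
      have h := cocycle_skew K x.1 x.1
      rw [← two_smul K] at h
      exact (smul_eq_zero.mp h).resolve_left two_ne_zero
  leibniz_lie x y z :=
    Prod.ext (wittBracket_jacobi K x.1 y.1 z.1) (cocycle_jacobi K x.1 y.1 z.1)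

instance : LieAlgebra K (Virasoro K) where
  lie_smul t x y := Prod.ext (map_smul (wittBracket K x.1) t y.1) (map_smul (cocycle K x.1) t y.1)

theorem lie_def (x y : Virasoro K) : ⁅x, y⁆ = (wittBracket K x.1 y.1, cocycle K x.1 y.1) := rfl

theorem lie_e_e (i j : ℤ) :
    ⁅e K i, e K j⁆ = ((j : K) - (i : K)) • e K (i + j) +
      (if i + j = 0 then ((i : K) ^ 3 - (i : K)) / 12 else 0) • c K := by
  refine Prod.ext ?_ ?_
  · change wittBracket K (Finsupp.single i 1) (Finsupp.single j 1) =
      ((j : K) - (i : K)) • Finsupp.single (i + j) 1 + _ • (0 : ℤ →₀ K)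
    rw [wittBracket_single]
    simp
  · change cocycle K (Finsupp.single i 1) (Finsupp.single j 1) = _ • (0 : K) + _ • (1 : K)
    rw [cocycle_single]
    simp

theorem lie_c (x : Virasoro K) : ⁅x, c K⁆ = 0 :=
  Prod.ext (map_zero (wittBracket K x.1)) (map_zero (cocycle K x.1))

theorem c_lie (x : Virasoro K) : ⁅c K, x⁆ = 0 := by
  rw [← lie_skew, lie_c, neg_zero]

/-- For `k ≥ 0`, the span of `c` and of the `e_n` with `n ≥ k` is closed under the bracket. -/
theorem lie_mem_span (k : ℤ) (hk : 0 ≤ k) {x y : Virasoro K}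
    (hx : x ∈ Submodule.span K (insert (c K) {z | ∃ n : ℤ, k ≤ n ∧ z = e K n}))
    (hy : y ∈ Submodule.span K (insert (c K) {z | ∃ n : ℤ, k ≤ n ∧ z = e K n})) :
    ⁅x, y⁆ ∈ Submodule.span K (insert (c K) {z | ∃ n : ℤ, k ≤ n ∧ z = e K n}) := by
  induction hx, hy using Submodule.span_induction₂ with
  | mem_mem x y hx hy =>
    rcases hx with rfl | ⟨i, hi, rfl⟩
    · rw [c_lie]; exact Submodule.zero_mem _
    rcases hy with rfl | ⟨j, hj, rfl⟩
    · rw [lie_c]; exact Submodule.zero_mem _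
    rw [lie_e_e]
    refine Submodule.add_mem _ (Submodule.smul_mem _ _ (Submodule.subset_span ?_))
      (Submodule.smul_mem _ _ (Submodule.subset_span ?_))
    · exact Or.inr ⟨i + j, by omega, rfl⟩
    · exact Or.inl rfl
  | zero_left => simp
  | zero_right => simp
  | add_left x y z _ _ _ h₁ h₂ => rw [add_lie]; exact Submodule.add_mem _ h₁ h₂
  | add_right x y z _ _ _ h₁ h₂ => rw [lie_add]; exact Submodule.add_mem _ h₁ h₂
  | smul_left r x y _ _ h => rw [smul_lie]; exact Submodule.smul_mem _ _ h
  | smul_right r x y _ _ h => rw [lie_smul]; exact Submodule.smul_mem _ _ h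

/-- The subalgebra `𝔟₊ = 𝔫₊ ⊕ 𝔥`, spanned by `c` and the `e_n` with `n ≥ 0`. -/
def bPlus : LieSubalgebra K (Virasoro K) where
  toSubmodule := Submodule.span K (insert (c K) {z | ∃ n : ℤ, 0 ≤ n ∧ z = e K n})
  lie_mem' hx hy := lie_mem_span K 0 le_rfl hx hy

/-- The subalgebra `𝔫' = 𝔫₊ ⊕ K c`, spanned by `c` and the `e_n` with `n ≥ 1`. -/
def nPrime : LieSubalgebra K (Virasoro K) where
  toSubmodule := Submodule.span K (insert (c K) {z | ∃ n : ℤ, 1 ≤ n ∧ z = e K n})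
  lie_mem' hx hy := lie_mem_span K 1 zero_le_one hx hy

namespace bPlus

/-- The element `c` of `𝔟₊`. -/
def c : bPlus K := ⟨Virasoro.c K, Submodule.subset_span (Or.inl rfl)⟩

/-- The element `e_n` of `𝔟₊`, for `n ≥ 0`. -/
def e (n : ℕ) : bPlus K :=
  ⟨Virasoro.e K n, Submodule.subset_span (Or.inr ⟨n, Int.natCast_nonneg n, rfl⟩)⟩

end bPlus

namespace nPrime

/-- The element `c` of `𝔫'`. -/
def c : nPrime K := ⟨Virasoro.c K, Submodule.subset_span (Or.inl rfl)⟩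

/-- The element `e_{n+1}` of `𝔫'`, for `n ≥ 0`. -/
def eSucc (n : ℕ) : nPrime K :=
  ⟨Virasoro.e K (n + 1), Submodule.subset_span (Or.inr ⟨n + 1, by omega, rfl⟩)⟩

end nPrime

/-- The linear form on `𝔟₊` with `e_0 ↦ lam`, `c ↦ κ` and `e_n ↦ 0` for `n ≥ 1`. -/
def weight (κ lam : K) (x : bPlus K) : K := lam * x.1.1 0 + κ * x.1.2

theorem weight_lie (κ lam : K) (x y : bPlus K) : weight K κ lam ⁅x, y⁆ = 0 := by
  obtain ⟨x, hx⟩ := x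
  obtain ⟨y, hy⟩ := y
  change lam * (⁅x, y⁆ : Virasoro K).1 0 + κ * (⁅x, y⁆ : Virasoro K).2 = 0
  replace hx : x ∈ Submodule.span K (insert (c K) {z | ∃ n : ℤ, 0 ≤ n ∧ z = e K n}) := hx
  replace hy : y ∈ Submodule.span K (insert (c K) {z | ∃ n : ℤ, 0 ≤ n ∧ z = e K n}) := hy
  suffices h : (⁅x, y⁆ : Virasoro K).1 0 = 0 ∧ (⁅x, y⁆ : Virasoro K).2 = 0 by
    rw [h.1, h.2]; simp
  induction hx, hy using Submodule.span_induction₂ with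
  | mem_mem x y hx hy =>
    rcases hx with rfl | ⟨i, hi, rfl⟩
    · rw [c_lie]; exact ⟨rfl, rfl⟩
    rcases hy with rfl | ⟨j, hj, rfl⟩
    · rw [lie_c]; exact ⟨rfl, rfl⟩
    change wittBracket K (Finsupp.single i 1) (Finsupp.single j 1) 0 = 0 ∧
      cocycle K (Finsupp.single i 1) (Finsupp.single j 1) = 0
    rw [wittBracket_single, cocycle_single]
    by_cases h : i + j = 0
    · obtain rfl : i = 0 := by omega
      obtain rfl : j = 0 := by omega
      simp
    · rw [if_neg h, Finsupp.single_apply, if_neg h]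
      exact ⟨rfl, rfl⟩
  | zero_left => rw [zero_lie]; exact ⟨rfl, rfl⟩
  | zero_right => rw [lie_zero]; exact ⟨rfl, rfl⟩
  | add_left x y z _ _ _ h₁ h₂ =>
    rw [add_lie]
    exact ⟨(congrArg₂ (· + ·) h₁.1 h₂.1).trans (add_zero 0),
      (congrArg₂ (· + ·) h₁.2 h₂.2).trans (add_zero 0)⟩
  | add_right x y z _ _ _ h₁ h₂ =>
    rw [lie_add]
    exact ⟨(congrArg₂ (· + ·) h₁.1 h₂.1).trans (add_zero 0),
      (congrArg₂ (· + ·) h₁.2 h₂.2).trans (add_zero 0)⟩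
  | smul_left r x y _ _ h =>
    rw [smul_lie]
    exact ⟨(congrArg (r * ·) h.1).trans (mul_zero r), (congrArg (r * ·) h.2).trans (mul_zero r)⟩
  | smul_right r x y _ _ h =>
    rw [lie_smul]
    exact ⟨(congrArg (r * ·) h.1).trans (mul_zero r), (congrArg (r * ·) h.2).trans (mul_zero r)⟩

theorem weight_add (κ lam : K) (x y : bPlus K) :
    weight K κ lam (x + y) = weight K κ lam x + weight K κ lam y := by
  change lam * (x.1.1 0 + y.1.1 0) + κ * (x.1.2 + y.1.2) =
    lam * x.1.1 0 + κ * x.1.2 + (lam * y.1.1 0 + κ * y.1.2)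
  ring

theorem weight_smul (κ lam r : K) (x : bPlus K) :
    weight K κ lam (r • x) = r * weight K κ lam x := by
  change lam * (r * x.1.1 0) + κ * (r * x.1.2) = r * (lam * x.1.1 0 + κ * x.1.2)
  ring

/-- The one-dimensional representation of `𝔟₊` on which `c` acts as `κ`, `e_0` acts as `lam`, and
`e_n` acts as zero for `n ≥ 1`. -/
def OneDim (_κ _lam : K) : Type u := K

instance (κ lam : K) : AddCommGroup (OneDim K κ lam) := inferInstanceAs (AddCommGroup K)

instance (κ lam : K) : Module K (OneDim K κ lam) := inferInstanceAs (Module K K)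

instance (κ lam : K) : LieRingModule (bPlus K) (OneDim K κ lam) where
  bracket x m := weight K κ lam x • m
  add_lie x y m := by
    change weight K κ lam (x + y) • m = weight K κ lam x • m + weight K κ lam y • m
    rw [weight_add, add_smul]
  lie_add x m n := smul_add (weight K κ lam x) m n
  leibniz_lie x y m := by
    change weight K κ lam x • weight K κ lam y • m =
      weight K κ lam ⁅x, y⁆ • m + weight K κ lam y • weight K κ lam x • m
    rw [weight_lie, zero_smul, zero_add, smul_comm]

instance (κ lam : K) : LieModule K (bPlus K) (OneDim K κ lam) where
  smul_lie r x m := by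
    change weight K κ lam (r • x) • m = r • weight K κ lam x • m
    rw [weight_smul, mul_smul]
  lie_smul r x m := smul_comm (weight K κ lam x) r m

/-- The Verma module `U(Vir) ⊗_{U(𝔟₊)} K_{κ,lam}`. -/
abbrev Verma (κ lam : K) : Type _ := InducedModule K (bPlus K) (OneDim K κ lam)

/-- A representation of `𝔟₊` has central character `κ` if `c` acts on it as the scalar `κ`. -/
def HasCentralCharacter (M : Type w) [AddCommGroup M] [Module K M] [LieRingModule (bPlus K) M]
    (κ : K) : Prop :=
  ∀ m : M, ⁅bPlus.c K, m⁆ = κ • m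

/-- The representations `M` of `𝔟₊` that induce logarithmic representations of `Vir`. -/
structure IsLogarithmic (M : Type w) [AddCommGroup M] [Module K M] [LieRingModule (bPlus K) M]
    [LieModule K (bPlus K) M] : Prop where
  finite : Module.Finite K M
  lie_e : ∀ n : ℕ, 1 ≤ n → ∀ m : M, ⁅bPlus.e K n, m⁆ = 0
  scalar : ∃ κ : K, HasCentralCharacter K M κ
  not_semisimple : ¬ (LieModule.toEnd K (bPlus K) M (bPlus.e K 0)).IsSemisimple

/-- The one-dimensional representations `M` of `𝔫'` that induce Whittaker modules over `Vir`. -/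
structure IsWhittaker (M : Type w) [AddCommGroup M] [Module K M] [LieRingModule (nPrime K) M] :
    Prop where
  finrank_eq_one : Module.finrank K M = 1
  lie_e : ∀ n : ℕ, 3 ≤ n + 1 → ∀ m : M, ⁅nPrime.eSucc K n, m⁆ = 0
  scalar : ∃ κ : K, ∀ m : M, ⁅nPrime.c K, m⁆ = κ • m

/-- The two-sided ideal `(c - κ)` of `U(Vir)`. -/
def centralIdeal (κ : K) : TwoSidedIdeal (UniversalEnvelopingAlgebra K (Virasoro K)) :=
  TwoSidedIdeal.span
    {UniversalEnvelopingAlgebra.ι K (Virasoro.c K) -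
      algebraMap K (UniversalEnvelopingAlgebra K (Virasoro K)) κ}

end Virasoro

end

noncomputable section

/-! Let `J` be the ideal `(c - κ)` and `I` the annihilator. Centrality of `c` gives `J ≤ I`; the
content is `I ≤ J`. Modulo `J` the enveloping algebra is spanned by words in the `e_n`. Suppose an
element of `I`, of length at most `d`, has leading symbol `f` in the polynomial ring on the `X_n`.
As `I` is stable under commutators with every `e_n`, the space `V` of such symbols is stable under
the derivations `symbolDeriv n`.

Write `Vir = A ⊕ H`, where `H` is the subalgebra induced from and `A` is spanned by the remaining
`e_n`. The induced module maps to `U(A) ⊗ M`. On `1 ⊗ m`, a word of length `d` gives, up to shorter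
words, itself if its letters lie in `A`, and nothing if a letter lies in `H`. Let `A` act on
polynomials by derivations, apply the result to `X_0 ^ d` and set `X_0 = 0`: what remains is `d!`
times `negProj f`. Thus `negProj` kills `V`.

A subspace stable under all `symbolDeriv n` and killed by `negProj` is zero
(`eq_zero_of_negProj_symbolDeriv`): commutators move any variable to a far negative index, where
`negProj` detects it. So `f = 0`, the length drops, and the element descends into `J`
(`le_of_leading_symbol`).

No basis theorem is needed. Symbols form a relation `symbolRel`, possibly multivalued a priori; it
is enough that symbol zero forces lower degree. The module `U(A) ⊗ M` is built directly by
`complementAction`. -/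

namespace Virasoro

/-! ### Stable subspaces of the polynomial ring on symbols -/

section Polynomial

open MvPolynomial

variable (K : Type u) [Field K]

/-- The derivation `X_m ↦ (m - n) X_{n+m}` of the polynomial ring on the symbols of the `e_m`. -/
def symbolDeriv (n : ℤ) : Derivation K (MvPolynomial ℤ K) (MvPolynomial ℤ K) :=
  mkDerivation K fun m : ℤ => ((m : K) - (n : K)) • X (n + m)

/-- The algebra map `X_i ↦ -i X_i` for `i < 0` and `X_i ↦ 0` for `i ≥ 0`. -/
def negProj : MvPolynomial ℤ K →ₐ[K] MvPolynomial ℤ K :=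
  aeval fun i : ℤ => if i < 0 then (-(i : K)) • X i else 0

variable {K}

theorem symbolDeriv_X (n m : ℤ) :
    symbolDeriv K n (X m) = ((m : K) - (n : K)) • X (n + m) :=
  mkDerivation_X K _ m

/-- The commutator of two derivations is a derivation, hence determined on variables, and only `X (i
- n)` contributes. -/
theorem pderiv_symbolDeriv (i n : ℤ) (f : MvPolynomial ℤ K) :
    pderiv i (symbolDeriv K n f) =
      symbolDeriv K n (pderiv i f) + ((i : K) - 2 * (n : K)) • pderiv (i - n) f := by
  have h : ⁅(pderiv i : Derivation K (MvPolynomial ℤ K) (MvPolynomial ℤ K)), symbolDeriv K n⁆ = ((i : K) - 2 * (n : K)) • pderiv (i - n) := by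
    refine derivation_ext (R := K) fun m => ?_
    rw [Derivation.commutator_apply, Derivation.smul_apply, symbolDeriv_X, Derivation.map_smul,
      pderiv_X, pderiv_X, pderiv_X]
    by_cases hm : i = n + m
    · subst hm
      simp only [Pi.single_apply, add_sub_cancel_left, if_true]
      split_ifs
      · rw [Derivation.map_one_eq_zero, sub_zero]
        congr 1
        push_cast
        ring
      · rw [map_zero, sub_zero]
        congr 1
        push_cast
        ring
    · have hm' : m ≠ i - n := by omega
      simp only [Pi.single_apply]
      rw [if_neg (by omega), if_neg hm', smul_zero, smul_zero, zero_sub, neg_eq_zero]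
      split_ifs
      · exact Derivation.map_one_eq_zero _
      · exact map_zero _
  rw [← Derivation.smul_apply, ← h, Derivation.commutator_apply]
  abel

/-- Chain rule for a substitution that rescales `X j` by `-j` and mixes no variables. -/
theorem negProj_pderiv {j : ℤ} (hj : j < 0) (f : MvPolynomial ℤ K) :
    pderiv j (negProj K f) = (-(j : K)) • negProj K (pderiv j f) := by
  induction f using MvPolynomial.induction_on with
  | C a => simp [negProj]
  | add f g hf hg => simp only [map_add, hf, hg, smul_add]
  | mul_X f i hf =>
    rw [map_mul, Derivation.leibniz, Derivation.leibniz, hf]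
    simp only [smul_eq_mul, map_add, map_mul, smul_add]
    have hX : negProj K (X i) = if i < 0 then (-(i : K)) • X i else 0 := by simp [negProj]
    have h2 : pderiv j (negProj K (X i)) = (-(j : K)) • negProj K (pderiv j (X i)) := by
      rw [hX, pderiv_X]
      by_cases hij : j = i
      · subst hij
        simp [hj]
      · rw [Pi.single_eq_of_ne (Ne.symm hij), map_zero, smul_zero]
        split_ifs
        · rw [Derivation.map_smul, pderiv_X_of_ne (Ne.symm hij), smul_zero]
        · exact map_zero _
    rw [h2]
    simp only [mul_smul_comm]

theorem coeff_zero_negProj (f : MvPolynomial ℤ K) : coeff 0 (negProj K f) = coeff 0 f := by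
  have h : (constantCoeff.comp (negProj K : MvPolynomial ℤ K →+* MvPolynomial ℤ K)) =
      constantCoeff := by
    refine MvPolynomial.ringHom_ext (fun r => ?_) fun i => ?_
    · simp [negProj]
    · simp only [RingHom.comp_apply, negProj, RingHom.coe_coe, aeval_X, constantCoeff_X]
      split_ifs
      · simp [constantCoeff_eq]
      · exact map_zero _
  exact RingHom.congr_fun h f

/-- Both hypotheses pass from `V` to the span of its partial derivatives, so every iterated
derivative has zero image under `negProj`, hence zero constant term. In characteristic zero these
constant terms determine all coefficients. -/
theorem eq_zero_of_negProj_symbolDeriv [CharZero K] (V : Submodule K (MvPolynomial ℤ K))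
    (hV : ∀ f ∈ V, ∀ n, symbolDeriv K n f ∈ V) (hker : ∀ f ∈ V, negProj K f = 0)
    {f : MvPolynomial ℤ K} (hf : f ∈ V) : f = 0 := by
  -- The subspace is quantified inside, since the induction on the degree of `m` replaces `V` by
  -- `V'`.
  suffices H : ∀ (m : ℤ →₀ ℕ) (V : Submodule K (MvPolynomial ℤ K)),
      (∀ f ∈ V, ∀ n, symbolDeriv K n f ∈ V) → (∀ f ∈ V, negProj K f = 0) →
        ∀ f ∈ V, coeff m f = 0 from
    MvPolynomial.ext _ _ fun m => (H m V hV hker f hf).trans (coeff_zero m).symm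
  intro m
  induction hd : m.degree generalizing m with
  | zero =>
    intro V _ hker f hf
    rw [(Finsupp.degree_eq_zero_iff m).mp hd, ← coeff_zero_negProj, hker f hf, coeff_zero]
  | succ d ih =>
    intro V hV hker f hf
    obtain ⟨i, hi⟩ : ∃ i, m i ≠ 0 := by
      by_contra! h
      rw [show m = 0 from Finsupp.ext h, map_zero] at hd
      omega
    obtain ⟨m', rfl⟩ : ∃ m', m = m' + Finsupp.single i 1 :=
      ⟨m - Finsupp.single i 1, (tsub_add_cancel_of_le
        (Finsupp.single_le_iff.mpr (Nat.one_le_iff_ne_zero.mpr hi))).symm⟩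
    have hd' : m'.degree = d := by
      rw [map_add, Finsupp.degree_single] at hd
      omega
    let V' : Submodule K (MvPolynomial ℤ K) :=
      Submodule.span K {g | ∃ f ∈ V, ∃ i, g = pderiv i f}
    have hV' : ∀ g ∈ V', ∀ n, symbolDeriv K n g ∈ V' := by
      intro g hg n
      induction hg using Submodule.span_induction with
      | mem g hg =>
        obtain ⟨f, hf, i, rfl⟩ := hg
        rw [← sub_eq_of_eq_add (pderiv_symbolDeriv i n f)]
        exact sub_mem (Submodule.subset_span ⟨_, hV f hf n, i, rfl⟩)
          (Submodule.smul_mem _ _ (Submodule.subset_span ⟨f, hf, i - n, rfl⟩))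
      | zero => rw [map_zero]; exact zero_mem _
      | add x y _ _ hx hy => rw [map_add]; exact add_mem hx hy
      | smul a x _ hx => rw [Derivation.map_smul]; exact Submodule.smul_mem _ _ hx
    have hker' : ∀ g ∈ V', negProj K g = 0 := by
      intro g hg
      induction hg using Submodule.span_induction with
      | mem g hg =>
        obtain ⟨f, hf, i, rfl⟩ := hg
        -- The index `j` lies below all variables of `f`, so `pderiv j f = 0`, and below `2 * i`, so
        -- the scalar `2 * i - j` is nonzero.
        obtain ⟨j, hj, hij, hjf⟩ : ∃ j : ℤ, j < 0 ∧ j < 2 * i ∧ j ∉ f.vars := by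
          refine ⟨-(∑ k ∈ f.vars, (k.natAbs : ℤ)) - 2 * i.natAbs - 1, ?_, ?_, fun hj => ?_⟩
          · have : 0 ≤ ∑ k ∈ f.vars, (k.natAbs : ℤ) := Finset.sum_nonneg fun _ _ => by omega
            omega
          · have : 0 ≤ ∑ k ∈ f.vars, (k.natAbs : ℤ) := Finset.sum_nonneg fun _ _ => by omega
            omega
          · have := Finset.single_le_sum (f := fun k : ℤ => (k.natAbs : ℤ))
              (fun _ _ => by omega) hj
            omega
        -- The shift `j - i` is the one for which the commutator with `pderiv j` is a multiple of
        -- `pderiv i`.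
        have h₁ : negProj K (pderiv j (symbolDeriv K (j - i) f)) = 0 := by
          have := negProj_pderiv hj (symbolDeriv K (j - i) f)
          rw [hker _ (hV f hf _), map_zero] at this
          exact (smul_eq_zero.mp this.symm).resolve_left
            (neg_ne_zero.mpr (Int.cast_ne_zero.mpr hj.ne))
        rw [pderiv_symbolDeriv, pderiv_eq_zero_of_notMem_vars hjf, map_zero, zero_add,
          sub_sub_cancel, map_smul] at h₁
        refine (smul_eq_zero.mp h₁).resolve_left ?_
        rw [show (j : K) - 2 * ((j - i : ℤ) : K) = ((2 * i - j : ℤ) : K) by push_cast; ring]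
        exact Int.cast_ne_zero.mpr (by omega)
      | zero => exact map_zero _
      | add x y _ _ hx hy => rw [map_add, hx, hy, add_zero]
      | smul a x _ hx => rw [map_smul, hx, smul_zero]
    have := ih m' hd' V' hV' hker' _ (Submodule.subset_span ⟨f, hf, i, rfl⟩)
    rw [coeff_pderiv] at this
    exact (mul_eq_zero.mp this).resolve_right (by exact_mod_cast Nat.succ_ne_zero (m' i))

end Polynomial
end Virasoro

namespace Virasoro

/-! ### Word-length filtration and leading symbols modulo an ideal -/

section Words

open MvPolynomial

variable {K : Type u} [Field K] {B : Type v} [Ring B] [Algebra K B]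

/-- The span of a two-sided ideal and of the words of length less than `d` in the `E i`. -/
def wordFiltration (E : ℤ → B) (J : Ideal B) (d : ℕ) : Submodule K B :=
  J.restrictScalars K ⊔ Submodule.span K {b | ∃ l : List ℤ, l.length < d ∧ b = (l.map E).prod}

/-- The pairs of an element of degree at most `d` and of a symbol of degree `d` that represents it
up to elements of degree less than `d`. -/
def symbolRel (E : ℤ → B) (J : Ideal B) (d : ℕ) : Submodule K (B × MvPolynomial ℤ K) :=
  Submodule.span K
    ({p | ∃ l : List ℤ, l.length = d ∧ p = ((l.map E).prod, (l.map X).prod)} ∪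
      {p | p.1 ∈ wordFiltration (K := K) E J d ∧ p.2 = 0})

variable {E : ℤ → B} {J : Ideal B}

theorem ideal_le_wordFiltration (d : ℕ) {b : B} (hb : b ∈ J) :
    b ∈ wordFiltration (K := K) E J d :=
  Submodule.mem_sup_left hb

theorem word_mem_wordFiltration {l : List ℤ} {d : ℕ} (h : l.length < d) :
    (l.map E).prod ∈ wordFiltration (K := K) E J d :=
  Submodule.mem_sup_right (Submodule.subset_span ⟨l, h, rfl⟩)

theorem wordFiltration_le {d : ℕ} {S : Submodule K B} (hJ : ∀ b ∈ J, b ∈ S)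
    (hS : ∀ l : List ℤ, l.length < d → (l.map E).prod ∈ S) : wordFiltration E J d ≤ S := by
  refine sup_le hJ (Submodule.span_le.mpr ?_)
  rintro _ ⟨l, hl, rfl⟩
  exact hS l hl

theorem wordFiltration_mono {d d' : ℕ} (h : d ≤ d') :
    wordFiltration (K := K) E J d ≤ wordFiltration E J d' :=
  wordFiltration_le (fun _ hb => ideal_le_wordFiltration d' hb)
    fun _ hl => word_mem_wordFiltration (hl.trans_le h)

theorem mul_mem_wordFiltration {d : ℕ} (i : ℤ) {b : B} (hb : b ∈ wordFiltration (K := K) E J d) :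
    E i * b ∈ wordFiltration (K := K) E J (d + 1) := by
  refine wordFiltration_le (S := (wordFiltration E J (d + 1)).comap (LinearMap.mulLeft K (E i)))
    (fun b hb => ideal_le_wordFiltration _ (J.mul_mem_left _ hb)) (fun l hl => ?_) hb
  exact word_mem_wordFiltration (l := i :: l) (Nat.succ_lt_succ hl)

theorem word_mem_symbolRel (l : List ℤ) :
    ((l.map E).prod, (l.map X).prod) ∈ symbolRel (K := K) E J l.length :=
  Submodule.subset_span (Or.inl ⟨l, rfl, rfl⟩)

theorem mem_symbolRel_zero {d : ℕ} {b : B} (hb : b ∈ wordFiltration (K := K) E J d) :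
    (b, 0) ∈ symbolRel (K := K) E J d :=
  Submodule.subset_span (Or.inr ⟨hb, rfl⟩)

theorem symbolRel_le {d : ℕ} {S : Submodule K (B × MvPolynomial ℤ K)}
    (hl : ∀ l : List ℤ, l.length = d → ((l.map E).prod, (l.map X).prod) ∈ S)
    (hS : ∀ b ∈ wordFiltration (K := K) E J d, (b, 0) ∈ S) : symbolRel E J d ≤ S := by
  refine Submodule.span_le.mpr ?_
  rintro ⟨b, f⟩ (⟨l, hd, h⟩ | ⟨hb, rfl : f = 0⟩)
  · rw [h]; exact hl l hd
  · exact hS b hb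

theorem fst_mem_of_symbolRel {d : ℕ} {p : B × MvPolynomial ℤ K} (hp : p ∈ symbolRel E J d) :
    p.1 ∈ wordFiltration (K := K) E J (d + 1) :=
  symbolRel_le (S := (wordFiltration E J (d + 1)).comap (LinearMap.fst K B _))
    (fun _ hl => word_mem_wordFiltration (Nat.lt_succ_of_le hl.le))
    (fun _ hb => wordFiltration_mono (Nat.le_succ d) hb) hp

theorem exists_symbolRel {d : ℕ} {b : B} (hb : b ∈ wordFiltration (K := K) E J (d + 1)) :
    ∃ f, (b, f) ∈ symbolRel (K := K) E J d := by
  have : wordFiltration (K := K) E J (d + 1) ≤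
      (symbolRel (K := K) E J d).map (LinearMap.fst K B _) := by
    refine wordFiltration_le (fun b hb => ?_) fun l hl => ?_
    · exact ⟨(b, 0), mem_symbolRel_zero (ideal_le_wordFiltration d hb), rfl⟩
    · rcases (Nat.lt_succ_iff_lt_or_eq.mp hl) with h | rfl
      · exact ⟨_, mem_symbolRel_zero (word_mem_wordFiltration h), rfl⟩
      · exact ⟨_, word_mem_symbolRel l, rfl⟩
  obtain ⟨⟨_, f⟩, hf, rfl⟩ := this hb
  exact ⟨f, hf⟩

theorem mul_mem_symbolRel {d : ℕ} (i : ℤ) {p : B × MvPolynomial ℤ K} (hp : p ∈ symbolRel E J d) :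
    (E i * p.1, X i * p.2) ∈ symbolRel (K := K) E J (d + 1) := by
  refine symbolRel_le (S := (symbolRel E J (d + 1)).comap
    ((LinearMap.mulLeft K (E i)).prodMap (LinearMap.mulLeft K (X i)))) ?_ ?_ hp
  · rintro l rfl
    exact word_mem_symbolRel (i :: l)
  · intro b hb
    change (E i * b, X i * (0 : MvPolynomial ℤ K)) ∈ symbolRel E J (d + 1)
    rw [mul_zero]
    exact mem_symbolRel_zero (mul_mem_wordFiltration i hb)

variable [J.IsTwoSided] {a : ℤ → ℤ → K}
  (hE : ∀ i j, E i * E j - E j * E i - ((j : K) - (i : K)) • E (i + j) - a i j • 1 ∈ J)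

include hE

/-- Modulo `J` the commutator is a multiple of one letter plus a scalar. The scalar part has lower
degree and does not affect the symbol. -/
theorem commutator_word (i j : ℤ) {d : ℕ} {b : B} {f : MvPolynomial ℤ K}
    (hb : (b, f) ∈ symbolRel (K := K) E J d) :
    ((E i * E j - E j * E i) * b, symbolDeriv K i (X j) * f) ∈
      symbolRel (K := K) E J (d + 1) := by
  have h₁ := Submodule.smul_mem _ ((j : K) - (i : K)) (mul_mem_symbolRel (i + j) hb)
  have h₂ : ((E i * E j - E j * E i - ((j : K) - (i : K)) • E (i + j) - a i j • 1) * b,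
      (0 : MvPolynomial ℤ K)) ∈ symbolRel (K := K) E J (d + 1) :=
    mem_symbolRel_zero (ideal_le_wordFiltration _ (J.mul_mem_right _ (hE i j)))
  have h₃ : (b, (0 : MvPolynomial ℤ K)) ∈ symbolRel (K := K) E J (d + 1) :=
    mem_symbolRel_zero (fst_mem_of_symbolRel hb)
  convert add_mem (add_mem h₁ h₂) (Submodule.smul_mem _ (a i j) h₃) using 1
  refine Prod.ext ?_ ?_
  · simp only [Prod.fst_add, Prod.smul_fst, sub_mul, smul_mul_assoc, one_mul]
    abel
  · simp [symbolDeriv_X]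

/-- Swapping adjacent letters costs a commutator, which has one letter fewer modulo `J`. -/
theorem perm_word {l l' : List ℤ} (h : l.Perm l') :
    (l.map E).prod - (l'.map E).prod ∈ wordFiltration (K := K) E J l.length := by
  induction h with
  | nil => rw [sub_self]; exact zero_mem _
  | cons x _ ih =>
    rw [List.map_cons, List.map_cons, List.prod_cons, List.prod_cons, ← mul_sub]
    exact mul_mem_wordFiltration x ih
  | swap x y l =>
    simp only [List.map_cons, List.prod_cons, ← mul_assoc]
    rw [← sub_mul]
    exact fst_mem_of_symbolRel (commutator_word hE y x (word_mem_symbolRel l))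
  | trans h₁ _ ih₁ ih₂ =>
    rw [h₁.length_eq] at ih₁ ⊢
    rw [← sub_add_sub_cancel]
    exact add_mem ih₁ ih₂

/-- Choose a word for each monomial, giving a linear map `s` from polynomials to `B`. Since
reordering costs only lower terms, `b - s f` has lower degree whenever `f` is a symbol of `b`; then
put `f = 0`. -/
theorem mem_wordFiltration_of_symbolRel_zero {d : ℕ} {b : B}
    (hb : (b, 0) ∈ symbolRel (K := K) E J d) : b ∈ wordFiltration (K := K) E J d := by
  let s : MvPolynomial ℤ K →ₗ[K] B := (MvPolynomial.basisMonomials ℤ K).constr K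
    fun m => ((Finsupp.toMultiset m).toList.map E).prod
  have key : symbolRel (K := K) E J d ≤ (wordFiltration (K := K) E J d).comap
      (LinearMap.fst K B _ - s.comp (LinearMap.snd K B _)) := by
    refine symbolRel_le ?_ ?_
    · rintro l rfl
      have hl : (l.map (X : ℤ → MvPolynomial ℤ K)).prod =
          MvPolynomial.basisMonomials ℤ K (Multiset.toFinsupp (l : Multiset ℤ)) := by
        rw [coe_basisMonomials]
        clear hb
        induction l with
        | nil => simp
        | cons x l ih =>
          rw [List.map_cons, List.prod_cons, ih, ← Multiset.cons_coe, ← Multiset.singleton_add,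
            map_add, Multiset.toFinsupp_singleton, X, monomial_mul, one_mul]
      change (l.map E).prod - s (l.map X).prod ∈ wordFiltration E J l.length
      rw [hl, Module.Basis.constr_basis, Multiset.toFinsupp_toMultiset]
      exact perm_word hE (Multiset.coe_eq_coe.mp (Multiset.coe_toList _)).symm
    · intro b hb
      change b - s 0 ∈ wordFiltration E J d
      rwa [map_zero, sub_zero]
  have := key hb
  change b - s 0 ∈ wordFiltration E J d at this
  rwa [map_zero, sub_zero] at this

/-- Commuting with `E n` and `symbolDeriv K n` both obey the Leibniz rule, and they agree on single
letters up to scalars modulo `J`. -/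
theorem commutator_mem_symbolRel_word (n : ℤ) (l : List ℤ) :
    (E n * (l.map E).prod - (l.map E).prod * E n, symbolDeriv K n (l.map X).prod) ∈
      symbolRel (K := K) E J l.length := by
  induction l with
  | nil =>
    change (E n * 1 - 1 * E n, symbolDeriv K n 1) ∈ symbolRel E J 0
    rw [mul_one, one_mul, sub_self, Derivation.map_one_eq_zero]
    exact zero_mem _
  | cons x l ih =>
    have h := add_mem (commutator_word hE n x (word_mem_symbolRel l)) (mul_mem_symbolRel x ih)
    rw [List.length_cons]
    convert h using 1
    refine Prod.ext ?_ ?_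
    · simp only [List.map_cons, List.prod_cons, Prod.fst_add]
      noncomm_ring
    · simp only [List.map_cons, List.prod_cons, Prod.snd_add, Derivation.leibniz, smul_eq_mul]
      ring

theorem commutator_mem_symbolRel {d : ℕ} (n : ℤ) {p : B × MvPolynomial ℤ K}
    (hp : p ∈ symbolRel E J d) :
    (E n * p.1 - p.1 * E n, symbolDeriv K n p.2) ∈ symbolRel (K := K) E J d := by
  refine symbolRel_le (S := (symbolRel E J d).comap
    ((LinearMap.mulLeft K (E n) - LinearMap.mulRight K (E n)).prodMap
      (symbolDeriv K n : MvPolynomial ℤ K →ₗ[K] MvPolynomial ℤ K))) ?_ ?_ hp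
  · rintro l rfl
    exact commutator_mem_symbolRel_word hE n l
  · intro b hb
    change (E n * b - b * E n, symbolDeriv K n 0) ∈ symbolRel E J d
    rw [map_zero]
    refine mem_symbolRel_zero ?_
    refine wordFiltration_le (S := (wordFiltration E J d).comap
      (LinearMap.mulLeft K (E n) - LinearMap.mulRight K (E n))) (fun b hb => ?_)
      (fun l hl => ?_) hb
    · exact ideal_le_wordFiltration _ (sub_mem (J.mul_mem_left _ hb) (J.mul_mem_right _ hb))
    · exact wordFiltration_mono hl (fst_mem_of_symbolRel (commutator_mem_symbolRel_word hE n l))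

/-- The maps `F d` stand for the action on a vector, read in top degree: they vanish on `I` and on
lower terms, and see a symbol only through `negProj`. Descent on `d` ends at `d = 0`, where no words
are left and the filtration is `J` itself. -/
theorem le_of_leading_symbol [CharZero K] (hB : ∀ b, ∃ d, b ∈ wordFiltration (K := K) E J d)
    {I : Submodule K B} (hI : ∀ b ∈ I, ∀ n, E n * b - b * E n ∈ I)
    (F : ℕ → B →ₗ[K] MvPolynomial ℤ K) (hFI : ∀ d, ∀ b ∈ I, F d b = 0)
    (hFJ : ∀ d, ∀ b ∈ J, F d b = 0)
    (hF : ∀ d, ∀ l : List ℤ, l.length < d → F d (l.map E).prod = 0) {r : ℕ → K}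
    (hr : ∀ d, r d ≠ 0)
    (hF' : ∀ l : List ℤ, F l.length (l.map E).prod = r l.length • negProj K (l.map X).prod)
    {b : B} (hb : b ∈ I) : b ∈ J := by
  obtain ⟨d, hd⟩ := hB b
  induction d with
  | zero => exact wordFiltration_le (S := J.restrictScalars K) (fun _ h => h) (by simp) hd
  | succ d ih =>
    obtain ⟨f, hf⟩ := exists_symbolRel hd
    suffices hf0 : f = 0 by
      subst hf0
      exact ih (mem_wordFiltration_of_symbolRel_zero hE hf)
    -- The subspace consists of all symbols, in degree `d`, of elements of `I`.
    refine eq_zero_of_negProj_symbolDeriv ((symbolRel E J d ⊓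
      I.comap (LinearMap.fst K B _)).map (LinearMap.snd K B _)) ?_ ?_ ⟨(b, f), ⟨hf, hb⟩, rfl⟩
    · rintro _ ⟨p, ⟨hp, hpI⟩, rfl⟩ n
      exact ⟨_, ⟨commutator_mem_symbolRel hE n hp, hI _ hpI n⟩, rfl⟩
    · rintro _ ⟨p, ⟨hp, hpI⟩, rfl⟩
      have h : F d p.1 = r d • negProj K p.2 := by
        have hS : symbolRel E J d ≤ LinearMap.ker ((F d).comp (LinearMap.fst K B _) -
            r d • (negProj K).toLinearMap.comp (LinearMap.snd K B _)) := by
          refine symbolRel_le ?_ fun b hb => ?_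
          · rintro l rfl
            exact LinearMap.mem_ker.mpr (sub_eq_zero.mpr (hF' l))
          · refine LinearMap.mem_ker.mpr ?_
            change F d b - r d • negProj K 0 = 0
            rw [map_zero, smul_zero, sub_zero]
            exact wordFiltration_le (S := LinearMap.ker (F d)) (hFJ d) (hF d) hb
        exact sub_eq_zero.mp (LinearMap.mem_ker.mp (hS hp))
      change negProj K p.2 = 0
      rw [show F d p.1 = 0 from hFI d _ hpI] at h
      exact (smul_eq_zero.mp h.symm).resolve_left (hr d)

end Words
end Virasoro

/-! ### The module `U(A) ⊗ M` for a decomposition `L = A ⊕ H` -/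

section Complement

attribute [local instance 100] LieRing.ofAssociativeRing

variable (R : Type u) [CommRing R] {L : Type v} [LieRing L] [LieAlgebra R L]

/-- By the universal property the identity factors through the subalgebra generated by `L`, so that
subalgebra is everything. -/
theorem envelopingAlgebra_induction {motive : UniversalEnvelopingAlgebra R L → Prop}
    (one : motive 1) (smul : ∀ (r : R) a, motive a → motive (r • a))
    (add : ∀ a b, motive a → motive b → motive (a + b))
    (mul : ∀ x a, motive a → motive (UniversalEnvelopingAlgebra.ι R x * a))
    (a : UniversalEnvelopingAlgebra R L) : motive a := by
  have hgen : Algebra.adjoin R (Set.range (UniversalEnvelopingAlgebra.ι R (L := L))) = ⊤ := by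
    let S := Algebra.adjoin R (Set.range (UniversalEnvelopingAlgebra.ι R (L := L)))
    let f : L →ₗ⁅R⁆ S :=
      { toFun := fun x => ⟨UniversalEnvelopingAlgebra.ι R x, Algebra.subset_adjoin ⟨x, rfl⟩⟩
        map_add' := fun x y => Subtype.ext (map_add _ x y)
        map_smul' := fun r x => Subtype.ext (map_smul _ r x)
        map_lie' := fun {x y} => Subtype.ext (LieHom.map_lie _ x y) }
    have h : S.val.comp (UniversalEnvelopingAlgebra.lift R f) = AlgHom.id R _ := by
      refine UniversalEnvelopingAlgebra.hom_ext R (LieHom.ext fun x => ?_)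
      exact congrArg S.val (UniversalEnvelopingAlgebra.lift_ι_apply R f x)
    refine (Algebra.eq_top_iff).mpr fun a => ?_
    rw [← AlgHom.id_apply (R := R) a, ← h]
    exact (UniversalEnvelopingAlgebra.lift R f a).2
  have ha : a ∈ Algebra.adjoin R (Set.range (UniversalEnvelopingAlgebra.ι R (L := L))) :=
    hgen ▸ Algebra.mem_top
  suffices H : ∀ b, motive b → motive (a * b) by
    simpa using H 1 one
  induction ha using Algebra.adjoin_induction with
  | mem x hx => obtain ⟨x, rfl⟩ := hx; exact mul x
  | algebraMap r =>
    intro b hb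
    rw [← Algebra.smul_def]
    exact smul r b hb
  | add x y _ _ hx hy => intro b hb; rw [add_mul]; exact add _ _ (hx b hb) (hy b hb)
  | mul x y _ _ hx hy => intro b hb; rw [mul_assoc]; exact hx _ (hy b hb)

variable (A H : LieSubalgebra R L) (M : Type w) [AddCommGroup M] [Module R M]
  [LieRingModule H M] [LieModule R H M]

/-- The action of `A` on linear maps from `L` into a `U(A)`-module, `(a F)(x) = a F(x) - F [a, x]`. -/
def homAction (W : Type*) [AddCommGroup W] [Module R W] [Module (UniversalEnvelopingAlgebra R A) W]
    [IsScalarTower R (UniversalEnvelopingAlgebra R A) W] :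
    A →ₗ⁅R⁆ Module.End R (L →ₗ[R] W) where
  toFun a := LinearMap.compRight R (Algebra.lsmul R R W (UniversalEnvelopingAlgebra.ι R a)) -
      LinearMap.lcomp R W (LieAlgebra.ad R L a)
  map_add' a b := by
    ext F x
    simp
    abel
  map_smul' r a := by
    ext F x
    simp [smul_sub]
  map_lie' {a b} := by
    ext F x
    simp [LieRing.of_associative_ring_bracket, smul_sub]
    abel

theorem envelopingTensor_induction {motive : UniversalEnvelopingAlgebra R A ⊗[R] M → Prop}
    (zero : motive 0) (add : ∀ w w', motive w → motive w' → motive (w + w'))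
    (smul : ∀ (r : R) w, motive w → motive (r • w)) (one : ∀ m, motive (1 ⊗ₜ m))
    (ι_smul : ∀ (x : A) w, motive w → motive (UniversalEnvelopingAlgebra.ι R x • w))
    (w : UniversalEnvelopingAlgebra R A ⊗[R] M) : motive w := by
  induction w using TensorProduct.induction_on with
  | zero => exact zero
  | add w w' hw hw' => exact add w w' hw hw'
  | tmul a m =>
    induction a using envelopingAlgebra_induction with
    | one => exact one m
    | smul r a ha => rw [← TensorProduct.smul_tmul']; exact smul r _ ha
    | add a b ha hb => rw [TensorProduct.add_tmul]; exact add _ _ ha hb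
    | mul x a ha =>
      rw [← smul_eq_mul, ← TensorProduct.smul_tmul']
      exact ι_smul x _ ha

variable {A H} (pA : L →ₗ[R] A) (pH : L →ₗ[R] H)

/-- The action of `x = a + h` on the generators `1 ⊗ m` of `U(A) ⊗ M`. -/
def generatorAction : M →ₗ[R] L →ₗ[R] UniversalEnvelopingAlgebra R A ⊗[R] M :=
  LinearMap.mk₂ R (fun m x => UniversalEnvelopingAlgebra.ι R (pA x) ⊗ₜ m + 1 ⊗ₜ ⁅pH x, m⁆)
    (fun m m' x => by rw [TensorProduct.tmul_add, lie_add, TensorProduct.tmul_add]; abel)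
    (fun r m x => by rw [TensorProduct.tmul_smul, lie_smul, TensorProduct.tmul_smul, smul_add])
    (fun m x y => by
      rw [map_add, map_add, map_add, add_lie, TensorProduct.tmul_add, TensorProduct.add_tmul]
      abel)
    (fun r m x => by
      rw [map_smul, map_smul, map_smul, smul_lie, TensorProduct.tmul_smul,
        ← TensorProduct.smul_tmul', smul_add])

/-- The map `w ↦ (x ↦ x w)` describing the action of `L` on `U(A) ⊗ M`. -/
def complementOrbit : UniversalEnvelopingAlgebra R A ⊗[R] M →ₗ[R]
    L →ₗ[R] UniversalEnvelopingAlgebra R A ⊗[R] M :=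
  TensorProduct.lift <| LinearMap.mk₂ R
    (fun a m => UniversalEnvelopingAlgebra.lift R
      (homAction R A (UniversalEnvelopingAlgebra R A ⊗[R] M)) a (generatorAction R M pA pH m))
    (fun a b m => by rw [map_add, LinearMap.add_apply])
    (fun r a m => by rw [map_smul, LinearMap.smul_apply])
    (fun a m m' => by rw [map_add, map_add])
    (fun r a m => by rw [map_smul, map_smul])

variable {M}

theorem complementOrbit_one (m : M) (x : L) :
    complementOrbit R M pA pH (1 ⊗ₜ m) x =
      UniversalEnvelopingAlgebra.ι R (pA x) ⊗ₜ m + 1 ⊗ₜ ⁅pH x, m⁆ := by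
  change UniversalEnvelopingAlgebra.lift R (homAction R A _) 1 (generatorAction R M pA pH m) x = _
  rw [map_one]
  rfl

/-- The rule `x a = a x - [a, x]`, which any action must obey. It is built into `homAction`, so
extending from the generators `1 ⊗ m` enforces it. -/
theorem complementOrbit_ι_smul (a : A) (w : UniversalEnvelopingAlgebra R A ⊗[R] M) (x : L) :
    complementOrbit R M pA pH (UniversalEnvelopingAlgebra.ι R a • w) x =
      UniversalEnvelopingAlgebra.ι R a • complementOrbit R M pA pH w x -
        complementOrbit R M pA pH w ⁅(a : L), x⁆ := by
  induction w using TensorProduct.induction_on with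
  | zero => simp
  | add w w' hw hw' =>
    rw [smul_add, map_add, map_add, LinearMap.add_apply, LinearMap.add_apply, LinearMap.add_apply,
      smul_add, hw, hw']
    abel
  | tmul b m =>
    change UniversalEnvelopingAlgebra.lift R (homAction R A _) (UniversalEnvelopingAlgebra.ι R a * b)
      (generatorAction R M pA pH m) x = _
    rw [map_mul, UniversalEnvelopingAlgebra.lift_ι_apply]
    rfl

variable (hA : ∀ a : A, pA a = a) (hAH : ∀ a : A, pH a = 0)

include hA hAH in
theorem complementOrbit_left (w : UniversalEnvelopingAlgebra R A ⊗[R] M) (a : A) :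
    complementOrbit R M pA pH w a = UniversalEnvelopingAlgebra.ι R a • w := by
  induction w using envelopingTensor_induction generalizing a with
  | zero => simp
  | add w w' hw hw' => rw [map_add, LinearMap.add_apply, hw, hw', smul_add]
  | smul r w hw => rw [map_smul, LinearMap.smul_apply, hw, smul_comm]
  | one m =>
    rw [complementOrbit_one, hA, hAH, zero_lie, TensorProduct.tmul_zero, add_zero,
      TensorProduct.smul_tmul', smul_eq_mul, mul_one]
  | ι_smul b w hw =>
    rw [complementOrbit_ι_smul, hw, ← LieSubalgebra.coe_bracket, hw, LieHom.map_lie,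
      LieRing.of_associative_ring_bracket, sub_smul, mul_smul, mul_smul]
    abel

variable (hH : ∀ h : H, pH h = h) (hHA : ∀ h : H, pA h = 0) (hsum : ∀ x, (pA x : L) + pH x = x)

include hH hHA in
theorem complementOrbit_right (m : M) (h : H) :
    complementOrbit R M pA pH (1 ⊗ₜ m) h = 1 ⊗ₜ ⁅h, m⁆ := by
  rw [complementOrbit_one, hH, hHA, map_zero, TensorProduct.zero_tmul, zero_add]

include hA hAH hH hHA hsum in
-- If `x` or `y` lies in `A`, this is the commutation rule, up to skew-symmetry. On generators only
-- the case of two elements of `H` remains, where `M` is a module. Left multiplication by `A`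
-- propagates the identity through Jacobi.
theorem complementOrbit_lie (w : UniversalEnvelopingAlgebra R A ⊗[R] M) (x y : L) :
    complementOrbit R M pA pH w ⁅x, y⁆ =
      complementOrbit R M pA pH (complementOrbit R M pA pH w y) x -
        complementOrbit R M pA pH (complementOrbit R M pA pH w x) y := by
  have left (w : UniversalEnvelopingAlgebra R A ⊗[R] M) (a : A) (y : L) :
      complementOrbit R M pA pH w ⁅(a : L), y⁆ =
      complementOrbit R M pA pH (complementOrbit R M pA pH w y) a -
        complementOrbit R M pA pH (complementOrbit R M pA pH w a) y := by
    rw [complementOrbit_left R pA pH hA hAH, complementOrbit_left R pA pH hA hAH,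
      complementOrbit_ι_smul, sub_sub_cancel]
  induction w using envelopingTensor_induction generalizing x y with
  | zero => simp
  | add w w' hw hw' => simp only [map_add, LinearMap.add_apply, hw, hw']; abel
  | smul r w hw => simp only [map_smul, LinearMap.smul_apply, hw, smul_sub]
  | one m =>
    have right (h : H) (a : A) := congrArg Neg.neg (left (1 ⊗ₜ m) a h)
    have hh (h h' : H) : complementOrbit R M pA pH (1 ⊗ₜ m) ⁅(h : L), (h' : L)⁆ =
        complementOrbit R M pA pH (complementOrbit R M pA pH (1 ⊗ₜ m) h') h -
          complementOrbit R M pA pH (complementOrbit R M pA pH (1 ⊗ₜ m) h) h' := by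
      simp only [← LieSubalgebra.coe_bracket, complementOrbit_right R pA pH hH hHA, lie_lie,
        TensorProduct.tmul_sub]
    simp only [← map_neg, lie_skew, neg_sub] at right
    rw [← hsum x, ← hsum y]
    simp only [add_lie, lie_add, map_add, LinearMap.add_apply, left, right, hh]
    abel
  | ι_smul a w hw =>
    rw [complementOrbit_ι_smul, hw, leibniz_lie, map_add, hw ⁅(a : L), x⁆, hw x]
    simp only [complementOrbit_ι_smul, map_sub, LinearMap.sub_apply, smul_sub]
    abel

/-- The representation of `L` on `U(A) ⊗ M`, where `L = A ⊕ H` and `M` is a representation of `H`,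
in which `A` acts by left multiplication. -/
def complementAction : L →ₗ⁅R⁆ Module.End R (UniversalEnvelopingAlgebra R A ⊗[R] M) where
  toLinearMap := (complementOrbit R M pA pH).flip
  map_lie' {x y} := LinearMap.ext fun w =>
    complementOrbit_lie R pA pH hA hAH hH hHA hsum w x y

theorem lift_complementAction_incl (b : UniversalEnvelopingAlgebra R H) (m : M) :
    UniversalEnvelopingAlgebra.lift R (complementAction R (M := M) pA pH hA hAH hH hHA hsum)
      (envelopingIncl R H b) (1 ⊗ₜ m) = 1 ⊗ₜ envelopingAction R H M b m := by
  induction b using envelopingAlgebra_induction generalizing m with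
  | one => simp
  | smul r a ha => simp [ha]
  | add a b ha hb => simp [ha, hb, TensorProduct.tmul_add]
  | mul x a ha =>
    rw [map_mul, map_mul, map_mul, Module.End.mul_apply, Module.End.mul_apply, ha]
    rw [envelopingIncl, UniversalEnvelopingAlgebra.lift_ι_apply, envelopingAction,
      UniversalEnvelopingAlgebra.lift_ι_apply]
    change UniversalEnvelopingAlgebra.lift R (complementAction R pA pH hA hAH hH hHA hsum)
      (UniversalEnvelopingAlgebra.ι R (x : L)) _ = _
    rw [UniversalEnvelopingAlgebra.lift_ι_apply]
    exact complementOrbit_right R pA pH hH hHA _ x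

/-- The map `u ⊗ m ↦ u (1 ⊗ m)` kills the induced relations, so it factors through the induced
module. -/
theorem lift_complementAction_annihilator {u : UniversalEnvelopingAlgebra R L}
    (hu : u ∈ Module.annihilator (UniversalEnvelopingAlgebra R L) (InducedModule R H M)) (m : M) :
    UniversalEnvelopingAlgebra.lift R (complementAction R (M := M) pA pH hA hAH hH hHA hsum)
      u (1 ⊗ₜ m) = 0 := by
  let θ := UniversalEnvelopingAlgebra.lift R
    (complementAction R (M := M) pA pH hA hAH hH hHA hsum)
  let Λ : UniversalEnvelopingAlgebra R L ⊗[R] M →ₗ[R] UniversalEnvelopingAlgebra R A ⊗[R] M :=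
    TensorProduct.lift (LinearMap.mk₂ R (fun a m => θ a (1 ⊗ₜ m))
      (fun a b m => by rw [map_add, LinearMap.add_apply])
      (fun r a m => by rw [map_smul, LinearMap.smul_apply])
      (fun a m m' => by rw [TensorProduct.tmul_add, map_add])
      (fun r a m => by rw [TensorProduct.tmul_smul, map_smul]))
  have hΛ (a : UniversalEnvelopingAlgebra R L) (t) : Λ (a • t) = θ a (Λ t) := by
    induction t using TensorProduct.induction_on with
    | zero => simp
    | add t t' h h' => rw [smul_add, map_add, h, h', map_add, map_add]
    | tmul b m =>
      change θ (a * b) _ = θ a (θ b _)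
      rw [map_mul, Module.End.mul_apply]
  have hker : ∀ t ∈ inducedRelations R H M, Λ t = 0 := by
    intro t ht
    induction ht using Submodule.span_induction with
    | mem t ht =>
      obtain ⟨a, b, m, rfl⟩ := ht
      rw [map_sub, sub_eq_zero]
      change θ (a * envelopingIncl R H b) _ = θ a _
      rw [map_mul, Module.End.mul_apply]
      exact congrArg (θ a) (lift_complementAction_incl R pA pH hA hAH hH hHA hsum b m)
    | zero => exact map_zero Λ
    | add t t' _ _ h h' => rw [map_add, h, h', add_zero]
    | smul a t _ h => rw [hΛ, h, map_zero]
  have h := Module.mem_annihilator.mp hu (Submodule.Quotient.mk (1 ⊗ₜ m))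
  rw [← Submodule.Quotient.mk_smul, Submodule.Quotient.mk_eq_zero] at h
  have := hker _ h
  rwa [TensorProduct.smul_tmul', smul_eq_mul, mul_one] at this

variable (A M) in
/-- The span of the `a ⊗ m` with `a` a product of fewer than `d` elements of `A`. -/
def complementFiltration (d : ℕ) : Submodule R (UniversalEnvelopingAlgebra R A ⊗[R] M) :=
  Submodule.span R {w | ∃ l : List A, l.length < d ∧ ∃ m : M,
    w = (l.map (UniversalEnvelopingAlgebra.ι R)).prod ⊗ₜ m}

theorem complementFiltration_mono {d d' : ℕ} (h : d ≤ d') :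
    complementFiltration R A M d ≤ complementFiltration R A M d' :=
  Submodule.span_mono fun _ ⟨l, hl, m, hw⟩ => ⟨l, hl.trans_le h, m, hw⟩

theorem ι_smul_mem_complementFiltration {d : ℕ} (a : A)
    {w : UniversalEnvelopingAlgebra R A ⊗[R] M} (hw : w ∈ complementFiltration R A M d) :
    UniversalEnvelopingAlgebra.ι R a • w ∈ complementFiltration R A M (d + 1) := by
  induction hw using Submodule.span_induction with
  | mem w hw =>
    obtain ⟨l, hl, m, rfl⟩ := hw
    exact Submodule.subset_span ⟨a :: l, Nat.succ_lt_succ hl, m, rfl⟩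
  | zero => rw [smul_zero]; exact zero_mem _
  | add x y _ _ hx hy => rw [smul_add]; exact add_mem hx hy
  | smul r x _ hx => rw [smul_comm]; exact Submodule.smul_mem _ _ hx

include hA hAH hH hHA hsum

/-- Elements of `H` do not raise the degree: moving `h` past a letter `a` leaves `[a, h]`, whose
`A`-part takes the place of `a` and whose `H`-part acts on a shorter word. -/
theorem complementOrbit_right_word (l : List A) (m : M) (h : H) :
    complementOrbit R M pA pH ((l.map (UniversalEnvelopingAlgebra.ι R)).prod ⊗ₜ m) h ∈
      complementFiltration R A M (l.length + 1) := by
  induction l generalizing h with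
  | nil =>
    change complementOrbit R M pA pH (1 ⊗ₜ m) h ∈ _
    rw [complementOrbit_right R pA pH hH hHA]
    exact Submodule.subset_span ⟨[], Nat.zero_lt_one, _, rfl⟩
  | cons a l ih =>
    rw [List.map_cons, List.prod_cons, ← smul_eq_mul, ← TensorProduct.smul_tmul',
      complementOrbit_ι_smul]
    refine sub_mem (ι_smul_mem_complementFiltration R a (ih h)) ?_
    rw [← hsum ⁅(a : L), (h : L)⁆, map_add]
    refine add_mem ?_ (complementFiltration_mono R (Nat.le_succ _) (ih _))
    rw [complementOrbit_left R pA pH hA hAH]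
    exact ι_smul_mem_complementFiltration R _
      (Submodule.subset_span ⟨l, Nat.lt_succ_self _, m, rfl⟩)

theorem complementOrbit_right_mem {d : ℕ} {w : UniversalEnvelopingAlgebra R A ⊗[R] M}
    (hw : w ∈ complementFiltration R A M d) (h : H) :
    complementOrbit R M pA pH w h ∈ complementFiltration R A M d := by
  induction hw using Submodule.span_induction with
  | mem w hw =>
    obtain ⟨l, hl, m, rfl⟩ := hw
    exact complementFiltration_mono R hl
      (complementOrbit_right_word R pA pH hA hAH hH hHA hsum l m h)
  | zero => rw [map_zero]; exact zero_mem _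
  | add x y _ _ hx hy => rw [map_add]; exact add_mem hx hy
  | smul r x _ hx => rw [map_smul]; exact Submodule.smul_mem _ _ hx

theorem complementOrbit_mem {d : ℕ} {w : UniversalEnvelopingAlgebra R A ⊗[R] M}
    (hw : w ∈ complementFiltration R A M d) (x : L) :
    complementOrbit R M pA pH w x ∈ complementFiltration R A M (d + 1) := by
  rw [← hsum x, map_add, complementOrbit_left R pA pH hA hAH]
  exact add_mem (ι_smul_mem_complementFiltration R _ hw) (complementFiltration_mono R
    (Nat.le_succ d) (complementOrbit_right_mem R pA pH hA hAH hH hHA hsum hw _))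

theorem lift_complementAction_cons (x : L) (l : List L)
    (w : UniversalEnvelopingAlgebra R A ⊗[R] M) :
    UniversalEnvelopingAlgebra.lift R (complementAction R (M := M) pA pH hA hAH hH hHA hsum)
      ((x :: l).map (UniversalEnvelopingAlgebra.ι R)).prod w =
    complementOrbit R M pA pH
      (UniversalEnvelopingAlgebra.lift R (complementAction R (M := M) pA pH hA hAH hH hHA hsum)
        (l.map (UniversalEnvelopingAlgebra.ι R)).prod w) x := by
  rw [List.map_cons, List.prod_cons, map_mul, Module.End.mul_apply,
    UniversalEnvelopingAlgebra.lift_ι_apply]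
  rfl

theorem lift_complementAction_word (l : List L) (m : M) :
    UniversalEnvelopingAlgebra.lift R (complementAction R (M := M) pA pH hA hAH hH hHA hsum)
      (l.map (UniversalEnvelopingAlgebra.ι R)).prod (1 ⊗ₜ m) ∈
        complementFiltration R A M (l.length + 1) := by
  induction l with
  | nil =>
    rw [List.map_nil, List.prod_nil, map_one]
    exact Submodule.subset_span ⟨[], Nat.zero_lt_one, m, rfl⟩
  | cons x l ih =>
    rw [lift_complementAction_cons]
    exact complementOrbit_mem R pA pH hA hAH hH hHA hsum ih x

/-- The letter in `H` does not raise the degree and every other letter raises it by at most one. -/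
theorem lift_complementAction_word_of_mem (l : List L) (m : M) {x : L} (hxl : x ∈ l)
    (hx : x ∈ H) :
    UniversalEnvelopingAlgebra.lift R (complementAction R (M := M) pA pH hA hAH hH hHA hsum)
      (l.map (UniversalEnvelopingAlgebra.ι R)).prod (1 ⊗ₜ m) ∈
        complementFiltration R A M l.length := by
  induction l with
  | nil => simp at hxl
  | cons y l ih =>
    rw [lift_complementAction_cons]
    rcases List.mem_cons.mp hxl with rfl | h
    · exact complementOrbit_right_mem R pA pH hA hAH hH hHA hsum
        (lift_complementAction_word R pA pH hA hAH hH hHA hsum l m) ⟨x, hx⟩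
    · exact complementOrbit_mem R pA pH hA hAH hH hHA hsum (ih h) y

theorem lift_complementAction_left_word (l : List A) (m : M) :
    UniversalEnvelopingAlgebra.lift R (complementAction R (M := M) pA pH hA hAH hH hHA hsum)
      ((l.map ((↑) : A → L)).map (UniversalEnvelopingAlgebra.ι R)).prod (1 ⊗ₜ m) =
        (l.map (UniversalEnvelopingAlgebra.ι R)).prod ⊗ₜ m := by
  induction l with
  | nil => rw [List.map_nil, List.map_nil, List.prod_nil, map_one]; rfl
  | cons x l ih =>
    rw [List.map_cons, lift_complementAction_cons, ih, complementOrbit_left R pA pH hA hAH,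
      TensorProduct.smul_tmul']
    rfl

end Complement

/-- To bring the exponent of `x` down to `n`, each derivation must hit a power of `x`; every other
Leibniz term keeps a factor `x ^ (n + 1)`. -/
theorem derivation_word_pow {K R : Type*} [CommRing K] [CommRing R] [Algebra K R]
    (l : List (Derivation K R R)) (n : ℕ) (x : R) :
    ∃ g, (l.map fun D => (D.toLinearMap : Module.End K R)).prod (x ^ (n + l.length)) =
      ((n + l.length).descFactorial l.length : R) * x ^ n * (l.map fun D => D x).prod +
        x ^ (n + 1) * g := by
  induction l generalizing n with
  | nil => exact ⟨0, by simp⟩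
  | cons D l ih =>
    obtain ⟨g, hg⟩ := ih (n + 1)
    refine ⟨((n + 1 + l.length).descFactorial l.length : R) * D (l.map fun D => D x).prod +
      (n + 2) * D x * g + x * D g, ?_⟩
    rw [List.length_cons, show n + (l.length + 1) = n + 1 + l.length by ring, List.map_cons,
      List.prod_cons, Module.End.mul_apply, hg, Nat.descFactorial_succ]
    have h : n + 1 + l.length - l.length = n + 1 := by omega
    simp only [Derivation.coeFn_coe, map_add, Derivation.leibniz, Derivation.leibniz_pow,
      Derivation.map_natCast, smul_eq_mul, nsmul_eq_mul, h, List.map_cons, List.prod_cons,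
      Nat.add_sub_cancel]
    push_cast
    ring

/-! ### Splitting the Virasoro algebra, and detecting top-degree terms -/

namespace Virasoro

attribute [local instance 100] LieRing.ofAssociativeRing

variable (K : Type u) [Field K]

theorem mem_span_basis (x : Virasoro K) :
    x ∈ Submodule.span K (insert (c K) (Set.range (e K))) := by
  let i : (ℤ →₀ K) →ₗ[K] Virasoro K := LinearMap.inl K (ℤ →₀ K) K
  have hi (f : ℤ →₀ K) : i f ∈ Submodule.span K (insert (c K) (Set.range (e K))) := by
    induction f using Finsupp.induction_linear with
    | zero => rw [map_zero]; exact zero_mem _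
    | add f g hf hg => rw [map_add]; exact add_mem hf hg
    | single n r =>
      rw [← Finsupp.smul_single_one, map_smul]
      exact Submodule.smul_mem _ r (Submodule.subset_span (Or.inr ⟨n, rfl⟩))
  have hx : x = i x.1 + x.2 • c K :=
    Prod.ext ((add_zero x.1).symm.trans (congrArg (x.1 + ·) (smul_zero x.2).symm))
      ((mul_one x.2).symm.trans (zero_add (x.2 * 1)).symm)
  rw [hx]
  exact add_mem (hi _) (Submodule.smul_mem _ _ (Submodule.subset_span (Or.inl rfl)))

/-- The span of the `e_n` with `n < k`, for `k ≤ 1`. -/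
def below [CharZero K] (k : ℤ) (hk : k ≤ 1) : LieSubalgebra K (Virasoro K) where
  toSubmodule := Submodule.span K {z | ∃ n : ℤ, n < k ∧ z = e K n}
  lie_mem' {x y} hx hy := by
    replace hx : x ∈ Submodule.span K {z | ∃ n : ℤ, n < k ∧ z = e K n} := hx
    replace hy : y ∈ Submodule.span K {z | ∃ n : ℤ, n < k ∧ z = e K n} := hy
    change ⁅x, y⁆ ∈ Submodule.span K {z | ∃ n : ℤ, n < k ∧ z = e K n}
    induction hx, hy using Submodule.span_induction₂ with
    | mem_mem x y hx hy =>
      obtain ⟨i, hi, rfl⟩ := hx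
      obtain ⟨j, hj, rfl⟩ := hy
      rw [lie_e_e]
      -- Indices below `k ≤ 1` are nonpositive, so a central term could arise only from `i = j = 0`,
      -- where the cocycle vanishes.
      have h : (if i + j = 0 then ((i : K) ^ 3 - (i : K)) / 12 else 0) = 0 := by
        split_ifs
        · obtain rfl : i = 0 := by omega
          simp
        · rfl
      rw [h, zero_smul, add_zero]
      by_cases h0 : i + j < k
      · exact Submodule.smul_mem _ _ (Submodule.subset_span ⟨_, h0, rfl⟩)
      · obtain rfl : i = j := by omega
        rw [sub_self, zero_smul]
        exact zero_mem _
    | zero_left => rw [zero_lie]; exact zero_mem _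
    | zero_right => rw [lie_zero]; exact zero_mem _
    | add_left x y z _ _ _ h₁ h₂ => rw [add_lie]; exact add_mem h₁ h₂
    | add_right x y z _ _ _ h₁ h₂ => rw [lie_add]; exact add_mem h₁ h₂
    | smul_left r x y _ _ h => rw [smul_lie]; exact Submodule.smul_mem _ _ h
    | smul_right r x y _ _ h => rw [lie_smul]; exact Submodule.smul_mem _ _ h

theorem isCompl_below [CharZero K] (k : ℤ) (hk : k ≤ 1) :
    IsCompl (below K k hk).toSubmodule
      (Submodule.span K (insert (c K) {z | ∃ n : ℤ, k ≤ n ∧ z = e K n})) := by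
  refine isCompl_iff.mpr ⟨Submodule.disjoint_def.mpr fun x hx hy => ?_,
    codisjoint_iff_le_sup.mpr fun x _ => ?_⟩
  · replace hx : x ∈ Submodule.span K {z | ∃ n : ℤ, n < k ∧ z = e K n} := hx
    have h₁ : x.2 = 0 ∧ ∀ n, k ≤ n → x.1 n = 0 := by
      clear hy
      induction hx using Submodule.span_induction with
      | mem x hx =>
        obtain ⟨i, hi, rfl⟩ := hx
        exact ⟨rfl, fun n hn => Finsupp.single_eq_of_ne (by omega)⟩
      | zero => exact ⟨rfl, fun _ _ => rfl⟩
      | add x y _ _ hx hy =>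
        exact ⟨(congrArg₂ (· + ·) hx.1 hy.1).trans (add_zero 0), fun n hn =>
          (congrArg₂ (· + ·) (hx.2 n hn) (hy.2 n hn)).trans (add_zero 0)⟩
      | smul r x _ hx =>
        exact ⟨(congrArg (r * ·) hx.1).trans (mul_zero r), fun n hn =>
          (congrArg (r * ·) (hx.2 n hn)).trans (mul_zero r)⟩
    have h₂ : ∀ n, n < k → x.1 n = 0 := by
      clear hx h₁
      induction hy using Submodule.span_induction with
      | mem x hx =>
        obtain rfl | ⟨i, hi, rfl⟩ := hx
        · exact fun _ _ => rfl
        · exact fun n hn => Finsupp.single_eq_of_ne (by omega)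
      | zero => exact fun _ _ => rfl
      | add x y _ _ hx hy =>
        exact fun n hn => (congrArg₂ (· + ·) (hx n hn) (hy n hn)).trans (add_zero 0)
      | smul r x _ hx => exact fun n hn => (congrArg (r * ·) (hx n hn)).trans (mul_zero r)
    exact Prod.ext (Finsupp.ext fun n => (lt_or_ge n k).elim (h₂ n) (h₁.2 n)) h₁.1
  · refine Submodule.span_le.mpr ?_ (mem_span_basis K x)
    rintro _ (rfl | ⟨n, rfl⟩)
    · exact Submodule.mem_sup_right (Submodule.subset_span (Or.inl rfl))
    · rcases lt_or_ge n k with h | h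
      · exact Submodule.mem_sup_left (Submodule.subset_span ⟨n, h, rfl⟩)
      · exact Submodule.mem_sup_right (Submodule.subset_span (Or.inr ⟨n, h, rfl⟩))

section Symbols

open MvPolynomial

/-- The action of the Virasoro algebra on the polynomial ring on the symbols of the `e_m`. -/
def symbolAction : Virasoro K →ₗ[K] Derivation K (MvPolynomial ℤ K) (MvPolynomial ℤ K) :=
  (Finsupp.linearCombination K (symbolDeriv K)).comp (LinearMap.fst K (ℤ →₀ K) K)

variable {K} in
theorem symbolAction_e (n : ℤ) : symbolAction K (e K n) = symbolDeriv K n :=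
  (Finsupp.linearCombination_single K 1 n).trans (one_smul K _)

theorem lie_symbolDeriv (i j : ℤ) :
    ⁅symbolDeriv K i, symbolDeriv K j⁆ = ((j : K) - (i : K)) • symbolDeriv K (i + j) := by
  refine derivation_ext fun m => ?_
  simp only [Derivation.commutator_apply, Derivation.smul_apply, symbolDeriv_X,
    Derivation.map_smul, smul_smul]
  rw [show j + (i + m) = i + (j + m) by ring, show i + j + m = i + (j + m) by ring, ← sub_smul]
  congr 1
  push_cast
  ring

theorem symbolAction_lie [CharZero K] (x y : Virasoro K) (p : MvPolynomial ℤ K) :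
    symbolAction K ⁅x, y⁆ p =
      symbolAction K x (symbolAction K y p) - symbolAction K y (symbolAction K x p) := by
  induction mem_span_basis K x, mem_span_basis K y using Submodule.span_induction₂ with
  | mem_mem x y hx hy =>
    have hc : symbolAction K (c K) = 0 := map_zero (Finsupp.linearCombination K (symbolDeriv K))
    obtain rfl | ⟨i, rfl⟩ := hx
    · simp [c_lie, hc]
    obtain rfl | ⟨j, rfl⟩ := hy
    · simp [lie_c, hc]
    rw [lie_e_e, map_add, map_smul, map_smul, hc, smul_zero, add_zero, symbolAction_e,
      symbolAction_e, symbolAction_e, ← lie_symbolDeriv, Derivation.commutator_apply]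
  | zero_left => simp
  | zero_right => simp
  | add_left x y z _ _ _ h₁ h₂ =>
    simp only [add_lie, map_add, Derivation.add_apply, h₁, h₂]; abel
  | add_right x y z _ _ _ h₁ h₂ =>
    simp only [lie_add, map_add, Derivation.add_apply, h₁, h₂]; abel
  | smul_left r x y _ _ h =>
    simp only [smul_lie, map_smul, Derivation.smul_apply, h, Derivation.map_smul, smul_sub]
  | smul_right r x y _ _ h =>
    simp only [lie_smul, map_smul, Derivation.smul_apply, h, Derivation.map_smul, smul_sub]

/-- The action of a subalgebra of the Virasoro algebra on the polynomial ring on symbols. -/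
def symbolRep [CharZero K] (A : LieSubalgebra K (Virasoro K)) :
    A →ₗ⁅K⁆ Module.End K (MvPolynomial ℤ K) where
  toFun x := (symbolAction K x).toLinearMap
  map_add' x y := LinearMap.ext fun p =>
    congrArg (fun D : Derivation K _ _ => D p) (map_add (symbolAction K) x.1 y.1)
  map_smul' r x := LinearMap.ext fun p =>
    congrArg (fun D : Derivation K _ _ => D p) (map_smul (symbolAction K) r x.1)
  map_lie' {x y} := LinearMap.ext fun p => symbolAction_lie K x y p

/-- Setting the symbol of `e_0` to zero. -/
def killZero : MvPolynomial ℤ K →ₐ[K] MvPolynomial ℤ K :=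
  aeval fun i : ℤ => if i = 0 then 0 else X i

variable {K} [CharZero K] (A : LieSubalgebra K (Virasoro K)) {M : Type w} [AddCommGroup M]
  [Module K M] (μ : M →ₗ[K] K)

/-- The map `a ⊗ m ↦ μ(m) a(X_0 ^ d)`, read at `X_0 = 0`. -/
def leadingSymbol (d : ℕ) :
    UniversalEnvelopingAlgebra K A ⊗[K] M →ₗ[K] MvPolynomial ℤ K :=
  TensorProduct.lift <| LinearMap.mk₂ K
    (fun a m => μ m • killZero K (UniversalEnvelopingAlgebra.lift K (symbolRep K A) a (X 0 ^ d)))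
    (fun a b m => by rw [map_add, LinearMap.add_apply, map_add, smul_add])
    (fun r a m => by rw [map_smul, LinearMap.smul_apply, map_smul, smul_comm])
    (fun a m m' => by rw [map_add, add_smul])
    (fun r a m => by rw [map_smul, smul_eq_mul, mul_smul])

/-- With exactly as many letters as powers of `X_0`, the surviving term is a factorial times a
commutative product. With fewer letters a power of `X_0` is left and `killZero` removes everything.
This separates top-degree words from shorter ones inside `U(A)`. -/
theorem killZero_word (l : List A) (n : ℕ) :
    killZero K (UniversalEnvelopingAlgebra.lift K (symbolRep K A)
      (l.map (UniversalEnvelopingAlgebra.ι K)).prod (X 0 ^ (n + l.length))) =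
    if n = 0 then (l.length.factorial : K) •
      (l.map fun x : A => killZero K (symbolAction K x (X 0))).prod else 0 := by
  obtain ⟨g, hg⟩ := derivation_word_pow (l.map fun x : A => symbolAction K x) n
    (X 0 : MvPolynomial ℤ K)
  have hX : killZero K (X 0) = 0 := by simp [killZero]
  have hl : UniversalEnvelopingAlgebra.lift K (symbolRep K A)
      (l.map (UniversalEnvelopingAlgebra.ι K)).prod =
      ((l.map fun x : A => symbolAction K x).map
        fun D => (D.toLinearMap : Module.End K (MvPolynomial ℤ K))).prod := by
    rw [map_list_prod, List.map_map, List.map_map]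
    congr 2
    funext x
    exact UniversalEnvelopingAlgebra.lift_ι_apply K _ x
  rw [List.length_map] at hg
  rw [hl, hg, map_add, map_mul, map_mul, map_mul, map_pow, map_pow, hX, zero_pow n.succ_ne_zero,
    zero_mul, add_zero]
  split_ifs with hn
  · subst hn
    rw [zero_add, Nat.descFactorial_self, map_natCast, pow_zero, mul_one, map_list_prod,
      List.map_map, List.map_map, Algebra.smul_def, map_natCast]
    rfl
  · rw [zero_pow hn, mul_zero, zero_mul]

theorem leadingSymbol_eq_zero {d : ℕ} {w : UniversalEnvelopingAlgebra K A ⊗[K] M}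
    (hw : w ∈ complementFiltration K A M d) : leadingSymbol A μ d w = 0 := by
  induction hw using Submodule.span_induction with
  | mem w hw =>
    obtain ⟨l, hl, m, rfl⟩ := hw
    have := killZero_word A l (d - l.length)
    rw [Nat.sub_add_cancel hl.le, if_neg (by omega)] at this
    exact (congrArg (μ m • ·) this).trans (smul_zero _)
  | zero => exact map_zero _
  | add x y _ _ hx hy => rw [map_add, hx, hy, add_zero]
  | smul r x _ hx => rw [map_smul, hx, smul_zero]

theorem leadingSymbol_word (l : List A) (m : M) :
    leadingSymbol A μ l.length ((l.map (UniversalEnvelopingAlgebra.ι K)).prod ⊗ₜ m) =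
      μ m • (l.length.factorial : K) •
        (l.map fun x : A => killZero K (symbolAction K x (X 0))).prod := by
  have := killZero_word A l 0
  rw [zero_add, if_pos rfl] at this
  exact congrArg (μ m • ·) this

end Symbols

end Virasoro

/-! ### Annihilators of modules induced to the Virasoro algebra -/

namespace Virasoro

attribute [local instance 100] LieRing.ofAssociativeRing

open UniversalEnvelopingAlgebra (ι)

variable {K : Type u} [Field K] [CharZero K] (κ : K)

theorem ι_c_sub_mem :
    ι K (c K) - algebraMap K (UniversalEnvelopingAlgebra K (Virasoro K)) κ ∈
      (centralIdeal K κ).asIdeal :=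
  TwoSidedIdeal.mem_asIdeal.mpr (TwoSidedIdeal.subset_span rfl)

theorem ι_c_commutes (a : UniversalEnvelopingAlgebra K (Virasoro K)) :
    ι K (c K) * a = a * ι K (c K) := by
  induction a using envelopingAlgebra_induction with
  | one => rw [mul_one, one_mul]
  | smul r a h => rw [mul_smul_comm, smul_mul_assoc, h]
  | add a b ha hb => rw [mul_add, add_mul, ha, hb]
  | mul x a h =>
    have hx : ι K (c K) * ι K x - ι K x * ι K (c K) = 0 := by
      rw [← LieRing.of_associative_ring_bracket, ← LieHom.map_lie, c_lie, map_zero]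
    rw [← mul_assoc, sub_eq_zero.mp hx, mul_assoc, h, mul_assoc]

theorem ι_commutator_mem (i j : ℤ) :
    ι K (e K i) * ι K (e K j) - ι K (e K j) * ι K (e K i) -
      ((j : K) - (i : K)) • ι K (e K (i + j)) -
      ((if i + j = 0 then ((i : K) ^ 3 - (i : K)) / 12 else 0) * κ) •
        (1 : UniversalEnvelopingAlgebra K (Virasoro K)) ∈ (centralIdeal K κ).asIdeal := by
  rw [← LieRing.of_associative_ring_bracket, ← LieHom.map_lie, lie_e_e, map_add, map_smul,
    map_smul, add_sub_cancel_left, mul_smul, ← Algebra.algebraMap_eq_smul_one, ← smul_sub,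
    Algebra.smul_def]
  exact Ideal.mul_mem_left _ _ (ι_c_sub_mem κ)

/-- Words in the `e_n` suffice, because modulo the ideal the letter `c` is the scalar `κ`. -/
theorem ι_mul_mem_wordFiltration (x : Virasoro K) {d : ℕ}
    {b : UniversalEnvelopingAlgebra K (Virasoro K)}
    (hb : b ∈ wordFiltration (K := K) (fun n => ι K (e K n)) (centralIdeal K κ).asIdeal d) :
    ι K x * b ∈
      wordFiltration (K := K) (fun n => ι K (e K n)) (centralIdeal K κ).asIdeal (d + 1) := by
  induction mem_span_basis K x using Submodule.span_induction with
  | mem x hx =>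
    obtain rfl | ⟨n, rfl⟩ := hx
    · have h := add_mem (ideal_le_wordFiltration (K := K) (E := fun n => ι K (e K n)) (d + 1)
        (Ideal.mul_mem_right b _ (ι_c_sub_mem κ)))
        (Submodule.smul_mem _ κ (wordFiltration_mono (Nat.le_succ d) hb))
      rwa [sub_mul, ← Algebra.smul_def, sub_add_cancel] at h
    · exact mul_mem_wordFiltration n hb
  | zero => rw [map_zero, zero_mul]; exact zero_mem _
  | add x y _ _ hx hy => rw [map_add, add_mul]; exact add_mem hx hy
  | smul r x _ hx => rw [map_smul, smul_mul_assoc]; exact Submodule.smul_mem _ _ hx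

theorem exists_mem_wordFiltration (b : UniversalEnvelopingAlgebra K (Virasoro K)) :
    ∃ d, b ∈ wordFiltration (K := K) (fun n => ι K (e K n)) (centralIdeal K κ).asIdeal d := by
  induction b using envelopingAlgebra_induction with
  | one => exact ⟨1, word_mem_wordFiltration (l := []) Nat.zero_lt_one⟩
  | smul r a h =>
    obtain ⟨d, h⟩ := h
    exact ⟨d, Submodule.smul_mem _ r h⟩
  | add a b ha hb =>
    obtain ⟨d, ha⟩ := ha
    obtain ⟨d', hb⟩ := hb
    exact ⟨max d d', add_mem (wordFiltration_mono (le_max_left d d') ha)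
      (wordFiltration_mono (le_max_right d d') hb)⟩
  | mul x a h =>
    obtain ⟨d, h⟩ := h
    exact ⟨d + 1, ι_mul_mem_wordFiltration κ x h⟩

open MvPolynomial in
omit [CharZero K] in
-- The derivation of `e_i` sends `X_0` to `-i X_i`. For `i = 0` this is zero, so `e_0` is invisible
-- even when it lies in `A`, and the same `negProj` serves `k = 0` and `k = 1`.
theorem prod_killZero_eq_negProj {k : ℤ} (hk : k ≤ 1) (l : List ℤ) (hl : ∀ i ∈ l, i < k) :
    (l.map fun i => killZero K (symbolAction K (e K i) (X 0))).prod =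
      negProj K (l.map X).prod := by
  rw [map_list_prod, List.map_map]
  refine congrArg List.prod (List.map_congr_left fun i hi => ?_)
  rw [symbolAction_e, symbolDeriv_X, map_smul, Function.comp_apply, add_zero, killZero, negProj,
    aeval_X, aeval_X, Int.cast_zero, zero_sub]
  rcases (show i < 0 ∨ i = 0 by have := hl i hi; omega) with h | rfl
  · rw [if_neg h.ne, if_pos h]
  · simp

variable {H : LieSubalgebra K (Virasoro K)} {M : Type w} [AddCommGroup M] [Module K M]
  [LieRingModule H M] [LieModule K H M] (cH : H) (hcH : (cH : Virasoro K) = c K)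

include hcH in
-- As `c` is central, it moves past `a` in `a ⊗ m` and then acts on `m` as `κ`.
theorem centralIdeal_le_annihilator (hM : ∀ m : M, ⁅cH, m⁆ = κ • m) :
    (centralIdeal K κ).asIdeal ≤ Module.annihilator (UniversalEnvelopingAlgebra K (Virasoro K))
      (InducedModule K H M) := by
  suffices h : centralIdeal K κ ≤ (Module.annihilator (UniversalEnvelopingAlgebra K (Virasoro K))
      (InducedModule K H M)).toTwoSided from
    fun u hu => Ideal.mem_toTwoSided.mp (h (TwoSidedIdeal.mem_asIdeal.mp hu))
  refine TwoSidedIdeal.span_le.mpr ?_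
  rintro _ rfl
  refine Ideal.mem_toTwoSided.mpr (Module.mem_annihilator.mpr fun v => ?_)
  obtain ⟨t, rfl⟩ := Submodule.Quotient.mk_surjective _ v
  rw [← Submodule.Quotient.mk_smul, Submodule.Quotient.mk_eq_zero]
  induction t using TensorProduct.induction_on with
  | zero => rw [smul_zero]; exact zero_mem _
  | add t t' h h' => rw [smul_add]; exact add_mem h h'
  | tmul a m =>
    refine Submodule.subset_span ⟨a, ι K cH, m, ?_⟩
    rw [envelopingIncl, envelopingAction, UniversalEnvelopingAlgebra.lift_ι_apply,
      UniversalEnvelopingAlgebra.lift_ι_apply, LieModule.toEnd_apply_apply, hM,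
      TensorProduct.smul_tmul', smul_eq_mul, sub_mul, TensorProduct.sub_tmul, ι_c_commutes,
      ← Algebra.smul_def, TensorProduct.smul_tmul]
    change _ = (a * ι K (cH : Virasoro K)) ⊗ₜ[K] m - _
    rw [hcH]

include hcH in
-- The common form of all four statements: `k = 0` gives `bPlus` and `k = 1` gives `nPrime`. Only
-- one nonzero vector of `M` and the action of `c` matter.
theorem inducedModule_annihilator_eq [Nontrivial M] {k : ℤ} (hk₀ : 0 ≤ k) (hk : k ≤ 1)
    (hH : H.toSubmodule = Submodule.span K (insert (c K) {z | ∃ n : ℤ, k ≤ n ∧ z = e K n}))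
    (hM : ∀ m : M, ⁅cH, m⁆ = κ • m) :
    Module.annihilator (UniversalEnvelopingAlgebra K (Virasoro K)) (InducedModule K H M) =
      (centralIdeal K κ).asIdeal := by
  have hJ := centralIdeal_le_annihilator κ cH hcH hM
  refine le_antisymm (fun u hu => ?_) hJ
  let A := below K k hk
  have hAH : IsCompl A.toSubmodule H.toSubmodule := hH ▸ isCompl_below K k hk
  let pA : Virasoro K →ₗ[K] A := A.toSubmodule.projectionOnto H.toSubmodule hAH
  let pH : Virasoro K →ₗ[K] H := H.toSubmodule.projectionOnto A.toSubmodule hAH.symm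
  have hpA (a : A) : pA a = a := Submodule.projectionOnto_apply_left hAH a
  have hpAH (a : A) : pH a = 0 := Submodule.projectionOnto_apply_right hAH.symm a
  have hpH (h : H) : pH h = h := Submodule.projectionOnto_apply_left hAH.symm h
  have hpHA (h : H) : pA h = 0 := Submodule.projectionOnto_apply_right hAH h
  have hsum (x : Virasoro K) : (pA x : Virasoro K) + pH x = x :=
    Submodule.projection_add_projection_eq_self hAH x
  obtain ⟨m, hm⟩ := exists_ne (0 : M)
  -- A functional with `μ m = 1` strips off the factor `M`, so that `leadingSymbol` takes values in
  -- polynomials.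
  obtain ⟨μ, hμ⟩ := Module.Projective.exists_dual_eq_one K hm
  let θ := UniversalEnvelopingAlgebra.lift K
    (complementAction K (M := M) pA pH hpA hpAH hpH hpHA hsum)
  refine le_of_leading_symbol (K := K) (E := fun n => ι K (e K n)) (ι_commutator_mem κ)
    (exists_mem_wordFiltration κ) (I := (Module.annihilator (UniversalEnvelopingAlgebra K
      (Virasoro K)) (InducedModule K H M)).restrictScalars K)
    (fun b hb n => sub_mem (Ideal.mul_mem_left _ _ hb) (Ideal.mul_mem_right _ _ hb))
    (fun d => (leadingSymbol A μ d).comp ((LinearMap.applyₗ (1 ⊗ₜ m)).comp θ.toLinearMap))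
    (fun d b hb => ?_) (fun d b hb => ?_) (fun d l hl => ?_) (r := fun d => (d.factorial : K))
    (fun d => Nat.cast_ne_zero.mpr d.factorial_ne_zero) (fun l => ?_) hu
  · exact (congrArg (leadingSymbol A μ d) (lift_complementAction_annihilator K pA pH hpA hpAH
      hpH hpHA hsum hb m)).trans (map_zero _)
  · exact (congrArg (leadingSymbol A μ d) (lift_complementAction_annihilator K pA pH hpA hpAH
      hpH hpHA hsum (hJ hb) m)).trans (map_zero _)
  · refine leadingSymbol_eq_zero A μ ?_
    have h := lift_complementAction_word K pA pH hpA hpAH hpH hpHA hsum (l.map (e K)) m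
    rw [List.map_map, List.length_map] at h
    exact complementFiltration_mono K hl h
  · change leadingSymbol A μ l.length (θ (l.map fun n => ι K (e K n)).prod (1 ⊗ₜ m)) = _
    have hmap : (l.map fun n => ι K (e K n)) = (l.map (e K)).map (ι K) := by
      rw [List.map_map]; rfl
    rw [hmap]
    -- If all letters lie in `A`, the word acts as itself and its top term is read off. Otherwise a
    -- letter in `H` lowers the degree, and `negProj` kills the symbol because that letter has index
    -- `i ≥ k ≥ 0`.
    by_cases hl : ∀ i ∈ l, i < k
    · obtain ⟨l', hl'⟩ : ∃ l' : List A, l'.map (↑) = l.map (e K) := by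
        have h : l.map (e K) ∈ Set.range (List.map ((↑) : A → Virasoro K)) := by
          rw [Set.range_list_map_coe]
          intro x hx
          obtain ⟨i, hi, rfl⟩ := List.mem_map.mp hx
          exact Submodule.subset_span ⟨i, hl i hi, rfl⟩
        exact h
      have hlen : l.length = l'.length := by
        rw [← List.length_map (as := l) (e K), ← hl', List.length_map]
      rw [← hl', lift_complementAction_left_word, hlen, leadingSymbol_word, hμ, one_smul,
        ← prod_killZero_eq_negProj hk l hl]
      have h := congrArg (List.map fun x => killZero K (symbolAction K x (MvPolynomial.X 0))) hl'
      rw [List.map_map, List.map_map] at h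
      exact congrArg (fun l => (l'.length.factorial : K) • List.prod l) h
    · push Not at hl
      obtain ⟨i, hi, hik⟩ := hl
      have hiH : e K i ∈ H := by
        change e K i ∈ H.toSubmodule
        rw [hH]
        exact Submodule.subset_span (Or.inr ⟨i, hik, rfl⟩)
      have h := lift_complementAction_word_of_mem K pA pH hpA hpAH hpH hpHA hsum (l.map (e K)) m
        (List.mem_map_of_mem hi) hiH
      rw [List.length_map] at h
      rw [leadingSymbol_eq_zero A μ h]
      have hX : negProj K (MvPolynomial.X i) = 0 := by
        rw [negProj, MvPolynomial.aeval_X, if_neg (by omega)]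
      rw [map_list_prod, List.map_map,
        List.prod_eq_zero (List.mem_map.mpr ⟨i, hi, hX⟩), smul_zero]

end Virasoro

end

theorem mainTheorem4 (K : Type u) [Field K] [CharZero K] :
    (∀ (κ : K) (M : Type v) [AddCommGroup M] [Module K M] [LieRingModule (Virasoro.bPlus K) M]
      [LieModule K (Virasoro.bPlus K) M] [Nontrivial M],
      Virasoro.HasCentralCharacter K M κ →
        Module.annihilator (UniversalEnvelopingAlgebra K (Virasoro K))
          (InducedModule K (Virasoro.bPlus K) M) = (Virasoro.centralIdeal K κ).asIdeal) ∧
    (∀ κ lam : K,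
      Module.annihilator (UniversalEnvelopingAlgebra K (Virasoro K)) (Virasoro.Verma K κ lam) =
        (Virasoro.centralIdeal K κ).asIdeal) ∧
    (∀ (M : Type v) [AddCommGroup M] [Module K M] [LieRingModule (Virasoro.bPlus K) M]
      [LieModule K (Virasoro.bPlus K) M],
      Virasoro.IsLogarithmic K M →
        ∃ κ : K, Virasoro.HasCentralCharacter K M κ ∧
          Module.annihilator (UniversalEnvelopingAlgebra K (Virasoro K))
            (InducedModule K (Virasoro.bPlus K) M) = (Virasoro.centralIdeal K κ).asIdeal) ∧
    (∀ (M : Type v) [AddCommGroup M] [Module K M] [LieRingModule (Virasoro.nPrime K) M]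
      [LieModule K (Virasoro.nPrime K) M],
      Virasoro.IsWhittaker K M →
        ∃ κ : K, (∀ m : M, ⁅Virasoro.nPrime.c K, m⁆ = κ • m) ∧
          Module.annihilator (UniversalEnvelopingAlgebra K (Virasoro K))
            (InducedModule K (Virasoro.nPrime K) M) = (Virasoro.centralIdeal K κ).asIdeal) := by
  have hbPlus (κ : K) (M : Type v) [AddCommGroup M] [Module K M]
      [LieRingModule (Virasoro.bPlus K) M] [LieModule K (Virasoro.bPlus K) M] [Nontrivial M]
      (hM : Virasoro.HasCentralCharacter K M κ) :=
    Virasoro.inducedModule_annihilator_eq κ (Virasoro.bPlus.c K) rfl le_rfl zero_le_one rfl hM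
  refine ⟨hbPlus, fun κ lam => ?_, fun M _ _ _ _ hM => ?_, fun M _ _ _ _ hM => ?_⟩
  · have : Nontrivial (Virasoro.OneDim K κ lam) := inferInstanceAs (Nontrivial K)
    refine Virasoro.inducedModule_annihilator_eq κ (Virasoro.bPlus.c K) rfl le_rfl zero_le_one rfl
      fun m => ?_
    change Virasoro.weight K κ lam (Virasoro.bPlus.c K) • m = κ • m
    congr 1
    change lam * 0 + κ * 1 = κ
    ring
  · obtain ⟨κ, hκ⟩ := hM.scalar
    -- On the zero module `e_0` would be the zero operator, which is semisimple.
    have : Nontrivial M := by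
      by_contra h
      rw [not_nontrivial_iff_subsingleton] at h
      refine hM.not_semisimple ?_
      rw [Subsingleton.elim (LieModule.toEnd K (Virasoro.bPlus K) M (Virasoro.bPlus.e K 0)) 0]
      exact Module.End.isSemisimple_zero
    exact ⟨κ, hκ, hbPlus κ M hκ⟩
  · obtain ⟨κ, hκ⟩ := hM.scalar
    have : Nontrivial M := Module.nontrivial_of_finrank_eq_succ hM.finrank_eq_one
    exact ⟨κ, hκ, Virasoro.inducedModule_annihilator_eq κ (Virasoro.nPrime.c K) rfl zero_le_one
      le_rfl rfl hκ⟩
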